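/- **Setting.** Fix a one-parameter canonical exponential family: a measure $\xi$ on $\mathbb{R}$ that is not carried by a single point, a nonempty open interval $\Theta\subseteq\mathbb{R}$ (possibly unbounded) and a function $b$ such that for each $\theta\in\Theta$ the function $f_\theta(x)=\exp(\theta x-b(\theta))$ is a probability density with respect to $\xi$; let $\nu_\theta$ be the distribution with this density and $\mu(\theta)$ its mean. Let $K\ge 2$. For $\theta=(\theta_1,\dots,\theta_K)\in\Theta^K$, let $\mathbb{P}_\theta$ be the law under which the rewards $(Y_{a,s})_{1\le a\le K,\,s\ge1}$ and the variables $(U_t)_{t\ge1}$ are independent, with $Y_{a,s}\sim\nu_{\theta_a}$ and $U_t$ uniform on $[0,1]$. A strategy $\mathcal{A}$ selects in each round $t\ge 1$ an arm $A_t\in\{1,\dots,K\}$ that is a measurable function of $(A_1,X_1,\dots,A_{t-1},X_{t-1},U_t)$, and then receives $X_t=Y_{A_t,N_{A_t}(t)}$, where $N_a(t)=\sum_{s=1}^t\mathbf{1}_{(A_s=a)}$. For a prior $H$ on $\Theta^K$, the Bayes risk is $$\mathcal{R}^H(T,\mathcal{A})=\int_{\Theta^K}\mathbb{E}_\theta\Big[\sum_{t=1}^T\big(\max_{a}\mu(\theta_a)-\mu(\theta_{A_t})\big)\Big]\,dH(\theta)\in[0,\infty].$$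 **Theorem.** Let $H$ be a product probability distribution on $\Theta^K$ whose $a$-th marginal has a density $h_a$ with respect to the Lebesgue measure with $h_a(\theta)>0$ for all $\theta\in\Theta$ ($a=1,\dots,K$). Let $\theta_{-a}=(\theta_i)_{i\ne a}$, let $H_{-a}$ be the marginal distribution of $\theta_{-a}$ and let $\theta_a^*=\max_{i\ne a}\theta_i$. Assume that $\int_{\Theta^{K-1}}h_a(\theta_a^*)\,dH_{-a}(\theta_{-a})<\infty$ for every $a=1,\dots,K$. Then for every strategy $\mathcal{A}$, which may depend on the horizon $T$, $$\liminf_{T\to\infty}\frac{\mathcal{R}^H(T,\mathcal{A})}{\log^2 T}\ \ge\ \frac12\sum_{a=1}^K\int_{\Theta^{K-1}}h_a(\theta_a^*)\,dH_{-a}(\theta_{-a}).$$ -/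

import Mathlib

open MeasureTheory ProbabilityTheory Filter
open scoped ENNReal

noncomputable section

namespace Bandit

/-- A one-parameter canonical exponential family: a reference measure `ξ` on `ℝ`, a nonempty open
interval `Θ` of natural parameters (possibly unbounded) and the log-partition function `b`, such
that `x ↦ exp (θ * x - b θ)` is a probability density with respect to `ξ` for every `θ ∈ Θ`.
The normalization determines `b` on `Θ`. The measure `ξ` is not carried by a single point, which is
what makes every variance `b'' θ` positive. -/
structure ExpFamily where
  /-- the reference measure -/
  ξ : Measure ℝ
  /-- the set of natural parameters -/
  Θ : Set ℝ
  /-- the log-partition function -/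
  b : ℝ → ℝ
  isOpen_Θ : IsOpen Θ
  ordConnected_Θ : Θ.OrdConnected
  nonempty_Θ : Θ.Nonempty
  normalized : ∀ θ ∈ Θ, ∫⁻ x, ENNReal.ofReal (Real.exp (θ * x - b θ)) ∂ξ = 1
  nondegenerate : ∀ c : ℝ, ξ {c}ᶜ ≠ 0

/-- The Lebesgue measure on the interval `Θ`. -/
def ExpFamily.lebesgue (F : ExpFamily) : Measure F.Θ :=
  (volume : Measure ℝ).comap Subtype.val

/-- The distribution `ν_θ`, with density `exp (θ x - b θ)` with respect to `ξ`. -/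
def ExpFamily.dist (F : ExpFamily) (θ : F.Θ) : Measure ℝ :=
  F.ξ.withDensity fun x => ENNReal.ofReal (Real.exp (θ * x - F.b θ))

instance ExpFamily.isProbabilityMeasure_dist (F : ExpFamily) (θ : F.Θ) :
    IsProbabilityMeasure (F.dist θ) :=
  ⟨by simpa [ExpFamily.dist] using F.normalized θ θ.2⟩

/-- The mean of `ν_θ`. -/
def ExpFamily.mean (F : ExpFamily) (θ : F.Θ) : ℝ := ∫ x, x ∂(F.dist θ)

/-- A (randomized, sequential) strategy for `K` arms. The arm drawn in the round that follows `t`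
completed rounds is a measurable function of the `t` past pairs (arm drawn, reward received) and of
a variable uniform on `[0, 1]`. -/
structure Strategy (K : ℕ) where
  /-- the selection rule -/
  select : (t : ℕ) → (Fin t → Fin K × ℝ) × unitInterval → Fin K
  measurable_select : ∀ t, Measurable (select t)

/-- The randomness of the game: the randomization variables `U_t`, and the reward `Y a s` given by
the `(s + 1)`-st draw of arm `a`. -/
abbrev Outcome (K : ℕ) : Type := (ℕ → unitInterval) × (Fin K → ℕ → ℝ)

/-- The pairs (arm drawn, reward received) in the first `t` rounds. If arm `a` is drawn and has been
drawn `n` times before, then the reward is `Y a n`. -/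
def Strategy.history {K : ℕ} (𝒜 : Strategy K) (ω : Outcome K) : (t : ℕ) → Fin t → Fin K × ℝ
  | 0 => Fin.elim0
  | t + 1 =>
    let past := 𝒜.history ω t
    let a := 𝒜.select t (past, ω.1 t)
    Fin.snoc (α := fun _ => Fin K × ℝ) past
      (a, ω.2 a (Finset.univ.filter fun s : Fin t => (past s).1 = a).card)

/-- The arm drawn in the round that follows `t` completed rounds. -/
def Strategy.arm {K : ℕ} (𝒜 : Strategy K) (ω : Outcome K) (t : ℕ) : Fin K :=
  𝒜.select t (𝒜.history ω t, ω.1 t)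

namespace ExpFamily

variable (F : ExpFamily) {K : ℕ}

/-- The law `P_θ`: the `U_t` are i.i.d. uniform, the rewards `Y a s` are i.i.d. with law `ν_{θ_a}`
for each arm `a`, and all these are independent. -/
def law (θ : Fin K → F.Θ) : Measure (Outcome K) :=
  (Measure.infinitePi fun _ : ℕ => (volume : Measure unitInterval)).prod
    (Measure.pi fun a => Measure.infinitePi fun _ : ℕ => F.dist (θ a))

/-- The regret `E_θ [∑_{t = 1}^T (μ* - μ_{A_t})]` after `T` rounds, with `μ*` the largest of the
means. All terms are nonnegative. -/
def regret (𝒜 : Strategy K) (T : ℕ) (θ : Fin K → F.Θ) : ℝ≥0∞ :=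
  ∫⁻ ω, ∑ t ∈ Finset.range T,
    ENNReal.ofReal ((⨆ a, F.mean (θ a)) - F.mean (θ (𝒜.arm ω t))) ∂(F.law θ)

/-- The Bayes risk after `T` rounds under the prior `H` on `Θ^K`; it may be infinite. -/
def bayesRisk (H : Measure (Fin K → F.Θ)) (𝒜 : Strategy K) (T : ℕ) : ℝ≥0∞ :=
  ∫⁻ θ, F.regret 𝒜 T θ ∂H

/-- The integral of `h(θ_a^*)` against `H_{-a} = ⨂_{i ≠ a} π i`, where `θ_a^* = max_{i ≠ a} θ_i`. -/
def crossIntegral (π : Fin K → Measure F.Θ) (h : ℝ → ℝ) (a : Fin K) : ℝ≥0∞ :=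
  ∫⁻ ϑ : {i : Fin K // i ≠ a} → F.Θ, ENNReal.ofReal (h (⨆ i, (ϑ i : ℝ)))
    ∂(Measure.pi fun i : {i : Fin K // i ≠ a} => π i)

end ExpFamily

end Bandit

end

noncomputable section

namespace Bandit

open scoped Topology

/-! ### Regularity of the exponential family near an interior parameter -/

namespace ExpFamily

variable (F : ExpFamily)

/-! Fix an arm `a` and the other parameters, and let t be the largest of these. Take `θ_a = t - δ`,
where arm `a` is slightly inferior, and `θ_a = t + ε δ`, where it is the best. A strategy that
rarely misses arm `a` in the second case must draw it about log(T δ²) / kl times in the first. With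
v = b''(t), one such draw costs about v δ and kl is about v δ² / 2, so the cost is about 2 log(T δ²)
/ δ. For δ = T^(-u) with 0 < u < 1/2 this is 2 (1 - 2u) log T / δ, while dδ becomes δ log T du in
absolute value. Integrating against the prior near t gives h_a(t) log² T ∫₀^{1/2} 2 (1 - 2u) du =
h_a(t) log² T / 2. It remains to integrate over the other parameters and to sum over `a`.

The information inequality is `le_add_lintegral_stopping`, carried over to the bandit by
`le_add_lintegral_pulls`. The misses under the superior parameter are not assumed to be few: they
are charged to the same Bayes risk with weight ε, at the price of a factor 1 + ε
(`sum_lintegral_le_bayesRisk`). The densities are only measurable, so continuity of translations in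
L¹ replaces continuity of `h a` (`lintegral_mul_le_liminf_translate`). `mul_crossIntegral_le_liminf`
assembles the bound for one arm, and finally ε tends to 0. The two-point estimate is made at each T
separately, so the strategy may depend on T. -/

lemma integrable_exp_sub {θ : ℝ} (hθ : θ ∈ F.Θ) :
    Integrable (fun x => Real.exp (θ * x - F.b θ)) F.ξ := by
  refine ⟨by fun_prop, ?_⟩
  rw [hasFiniteIntegral_iff_ofReal (ae_of_all _ fun x => (Real.exp_pos _).le), F.normalized θ hθ]
  exact ENNReal.one_lt_top

lemma integrable_exp_mul {θ : ℝ} (hθ : θ ∈ F.Θ) : Integrable (fun x => Real.exp (θ * x)) F.ξ := by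
  refine ((F.integrable_exp_sub hθ).const_mul (Real.exp (F.b θ))).congr (ae_of_all _ fun x => ?_)
  simp only [← Real.exp_add]
  ring_nf

lemma integral_exp_sub {θ : ℝ} (hθ : θ ∈ F.Θ) : ∫ x, Real.exp (θ * x - F.b θ) ∂F.ξ = 1 := by
  rw [integral_eq_lintegral_of_nonneg_ae (ae_of_all _ fun x => (Real.exp_pos _).le) (by fun_prop),
    F.normalized θ hθ, ENNReal.toReal_one]

lemma mgf_eq {θ : ℝ} (hθ : θ ∈ F.Θ) : mgf id F.ξ θ = Real.exp (F.b θ) := by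
  have h := F.integral_exp_sub hθ
  simp_rw [Real.exp_sub, integral_div] at h
  simpa [mgf] using (div_eq_one_iff_eq (Real.exp_pos _).ne').1 h

lemma cgf_eq {θ : ℝ} (hθ : θ ∈ F.Θ) : cgf id F.ξ θ = F.b θ := by
  rw [cgf, F.mgf_eq hθ, Real.log_exp]

lemma mem_interior {θ : ℝ} (hθ : θ ∈ F.Θ) : θ ∈ interior (integrableExpSet id F.ξ) :=
  interior_maximal (fun _ h => F.integrable_exp_mul h) F.isOpen_Θ hθ

lemma dist_eq_tilted (θ : F.Θ) : F.dist θ = F.ξ.tilted ((θ : ℝ) * id ·) := by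
  have h : ∫ x, Real.exp ((θ : ℝ) * id x) ∂F.ξ = Real.exp (F.b θ) := F.mgf_eq θ.2
  simp only [dist, Measure.tilted, h, Real.exp_sub]
  rfl

lemma mean_eq_deriv (θ : F.Θ) : F.mean θ = deriv (cgf id F.ξ) θ := by
  rw [← integral_tilted_mul_self (F.mem_interior θ.2), mean, F.dist_eq_tilted]
  rfl

lemma integrable_id_dist (θ : F.Θ) : Integrable (fun x => x) (F.dist θ) := by
  rw [F.dist_eq_tilted]
  exact memLp_one_iff_integrable.1 (memLp_tilted_mul (F.mem_interior θ.2) 1)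

/-- A vanishing variance would concentrate `F.dist θ` at a point, hence also `ξ`, which is
absolutely continuous with respect to it; `nondegenerate` forbids this. -/
lemma variance_dist_pos (θ : F.Θ) : 0 < iteratedDeriv 2 (cgf id F.ξ) θ := by
  rw [← variance_tilted_mul (F.mem_interior θ.2), ← F.dist_eq_tilted]
  refine (variance_nonneg _ _).lt_of_ne' fun h => ?_
  have hL : MemLp id 2 (F.dist θ) := by
    rw [F.dist_eq_tilted]
    exact memLp_tilted_mul (F.mem_interior θ.2) 2
  have h1 := ae_eq_integral_of_variance_eq_zero hL h
  have hac : F.ξ ≪ F.dist θ := by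
    refine withDensity_absolutelyContinuous' (by fun_prop) (ae_of_all _ fun x => ?_)
    simp [Real.exp_pos]
  exact F.nondegenerate _ (hac.ae_le h1)

lemma analyticAt_cgf {θ : ℝ} (hθ : θ ∈ F.Θ) : AnalyticAt ℝ (cgf id F.ξ) θ :=
  ProbabilityTheory.analyticAt_cgf (F.mem_interior hθ)

lemma hasStrictDerivAt_deriv_cgf {θ : ℝ} (hθ : θ ∈ F.Θ) :
    HasStrictDerivAt (deriv (cgf id F.ξ)) (iteratedDeriv 2 (cgf id F.ξ) θ) θ := by
  have h : iteratedDeriv 2 (cgf id F.ξ) θ = deriv (deriv (cgf id F.ξ)) θ := by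
    simp [iteratedDeriv_succ]
  rw [h]
  exact (F.analyticAt_cgf hθ).deriv.hasStrictDerivAt

/-- The derivative of the mean is the variance. Monotonicity makes the arm with the largest
parameter the one with the largest mean. -/
lemma strictMono_mean : StrictMono F.mean := by
  have h : StrictMonoOn (deriv (cgf id F.ξ)) F.Θ := by
    refine strictMonoOn_of_deriv_pos F.ordConnected_Θ.convex (fun x hx =>
      (F.hasStrictDerivAt_deriv_cgf hx).hasDerivAt.continuousAt.continuousWithinAt) fun x hx => ?_
    rw [F.isOpen_Θ.interior_eq] at hx
    rw [(F.hasStrictDerivAt_deriv_cgf hx).hasDerivAt.deriv]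
    exact F.variance_dist_pos ⟨x, hx⟩
  intro x y hxy
  rw [mean_eq_deriv, mean_eq_deriv]
  exact h x.2 y.2 hxy

lemma continuousOn_b : ContinuousOn F.b F.Θ := by
  refine ContinuousOn.congr (f := cgf id F.ξ)
    (fun x hx => (F.analyticAt_cgf hx).continuousAt.continuousWithinAt) fun x hx => ?_
  exact (F.cgf_eq hx).symm

lemma measurable_b : Measurable fun θ : F.Θ => F.b θ :=
  (continuousOn_iff_continuous_domRestrict.1 F.continuousOn_b).measurable

/-- `ξ` has a finite density, the inverse exponential, with respect to any member of the family.
Tonelli arguments over `ξ` rely on this. -/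
instance sigmaFinite_ξ : SigmaFinite F.ξ := by
  obtain ⟨θ, hθ⟩ := F.nonempty_Θ
  set f : ℝ → ℝ≥0∞ := fun x => ENNReal.ofReal (Real.exp (θ * x - F.b θ))
  have hf : Measurable f := by fun_prop
  have hi := withDensity_inv_same (μ := F.ξ) hf
    (ae_of_all _ fun x => by simp [f, Real.exp_pos]) (ae_of_all _ fun x => by simp [f])
  have : IsProbabilityMeasure (F.ξ.withDensity f) := F.isProbabilityMeasure_dist ⟨θ, hθ⟩
  rw [← hi]
  refine SigmaFinite.withDensity_of_ne_top (ae_of_all _ fun x => ?_)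
  simp [f, Real.exp_pos]

lemma measurable_dist : Measurable F.dist := by
  refine Measure.measurable_of_measurable_coe _ fun s hs => ?_
  simp only [dist, withDensity_apply _ hs]
  refine Measurable.lintegral_prod_right' (f := fun p : F.Θ × ℝ =>
    ENNReal.ofReal (Real.exp (p.1 * p.2 - F.b p.1))) ?_
  have := F.measurable_b.comp (measurable_fst : Measurable fun p : F.Θ × ℝ => p.1)
  exact ((((measurable_subtype_coe.comp measurable_fst).mul measurable_snd).sub
    this).exp).ennreal_ofReal

/-- The Kullback-Leibler divergence between two members of the family. -/
def kl (θ θ' : F.Θ) : ℝ := (θ - θ') * F.mean θ - F.b θ + F.b θ'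

/-- The log-likelihood ratio of `ν_θ` with respect to `ν_θ'`. -/
def llr (θ θ' : F.Θ) (x : ℝ) : ℝ := (θ - θ') * x - F.b θ + F.b θ'

lemma measurable_llr (θ θ' : F.Θ) : Measurable (F.llr θ θ') := by
  unfold llr; fun_prop

lemma integrable_llr (θ θ' : F.Θ) : Integrable (F.llr θ θ') (F.dist θ) :=
  (((F.integrable_id_dist θ).const_mul _).sub (integrable_const _)).add (integrable_const _)

lemma integral_llr (θ θ' : F.Θ) : ∫ x, F.llr θ θ' x ∂F.dist θ = F.kl θ θ' := by
  have h := (F.integrable_id_dist θ).const_mul ((θ : ℝ) - θ')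
  simp only [llr, kl]
  have h1 := integral_add (h.sub (integrable_const (F.b θ))) (integrable_const (F.b θ'))
  have h2 := integral_sub h (integrable_const (F.b θ))
  simp only [Pi.sub_apply] at h1 h2
  rw [h1, h2, integral_const_mul]
  simp [mean]

lemma dist_eq_withDensity (θ θ' : F.Θ) :
    F.dist θ' = (F.dist θ).withDensity fun x => ENNReal.ofReal (Real.exp (-F.llr θ θ' x)) := by
  have := F.measurable_llr θ θ'
  rw [dist, dist, ← withDensity_mul _ (by fun_prop) (by fun_prop)]
  congr 1
  ext x
  rw [Pi.mul_apply, ← ENNReal.ofReal_mul (Real.exp_pos _).le, ← Real.exp_add, llr]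
  ring_nf

/-- Near an interior parameter, the mean has slope `σ²` and the divergence is `σ² / 2` times the
squared distance, up to a factor close to `1`. -/
lemma eventually_local_bounds {t : ℝ} (ht : t ∈ F.Θ) {ε : ℝ} (hε : 0 < ε) :
    ∃ v > 0, ∀ᶠ δ in 𝓝[>] (0 : ℝ), ∃ (hm : t - δ ∈ F.Θ) (hp : t + ε * δ ∈ F.Θ),
      (1 - ε) * v * δ ≤ F.mean ⟨t, ht⟩ - F.mean ⟨t - δ, hm⟩ ∧
      (1 - ε) * v * (ε * δ) ≤ F.mean ⟨t + ε * δ, hp⟩ - F.mean ⟨t, ht⟩ ∧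
      F.kl ⟨t - δ, hm⟩ ⟨t + ε * δ, hp⟩ ≤ (1 + ε) * v * ((1 + ε) * δ) ^ 2 / 2 := by
  set v := iteratedDeriv 2 (cgf id F.ξ) t with hv
  have hv0 : 0 < v := F.variance_dist_pos ⟨t, ht⟩
  refine ⟨v, hv0, ?_⟩
  set m := deriv (cgf id F.ξ) with hm
  -- Strict differentiability controls difference quotients with both endpoints moving; the
  -- divergence below is based at t - δ, not at t.
  have hs := (F.hasStrictDerivAt_deriv_cgf ht).isLittleO.def (mul_pos hε hv0)
  rw [nhds_prod_eq] at hs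
  obtain ⟨s, hs, hs'⟩ := hs.exists_mem
  obtain ⟨s1, hs1, s2, hs2, h12⟩ := Filter.mem_prod_iff.1 hs
  obtain ⟨r, hr, hball⟩ := Metric.mem_nhds_iff.1
    (inter_mem (inter_mem hs1 hs2) (F.isOpen_Θ.mem_nhds ht))
  have key : ∀ x ∈ Metric.ball t r, ∀ y ∈ Metric.ball t r,
      |m x - m y - (x - y) * v| ≤ ε * v * |x - y| := by
    intro x hx y hy
    have := hs' (x, y) (h12 ⟨(hball hx).1.1, (hball hy).1.2⟩)
    simpa using this
  have hsmall : ∀ᶠ δ in 𝓝[>] (0 : ℝ), δ < r ∧ ε * δ < r := by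
    have h1 : ∀ᶠ δ in 𝓝 (0 : ℝ), δ < r := eventually_lt_nhds hr
    have h2 : ∀ᶠ δ in 𝓝 (0 : ℝ), ε * δ < r := by
      have : Tendsto (fun δ : ℝ => ε * δ) (𝓝 0) (𝓝 0) := by
        simpa using (continuous_const_mul ε).tendsto (0 : ℝ)
      exact this.eventually (eventually_lt_nhds hr)
    exact nhdsWithin_le_nhds (h1.and h2)
  filter_upwards [hsmall, self_mem_nhdsWithin] with δ ⟨h1, h2⟩ hδ
  have hδ : 0 < δ := hδ
  have hεδ : 0 < ε * δ := mul_pos hε hδ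
  have hbt : t ∈ Metric.ball t r := Metric.mem_ball_self hr
  have hbm : t - δ ∈ Metric.ball t r := by
    rw [Metric.mem_ball, Real.dist_eq, abs_lt]; constructor <;> linarith
  have hbp : t + ε * δ ∈ Metric.ball t r := by
    rw [Metric.mem_ball, Real.dist_eq, abs_lt]; constructor <;> linarith
  refine ⟨(hball hbm).2, (hball hbp).2, ?_, ?_, ?_⟩
  · rw [mean_eq_deriv, mean_eq_deriv]
    have := (abs_le.1 (key _ hbt _ hbm)).1
    rw [show t - (t - δ) = δ by ring, abs_of_pos hδ] at this
    simp only
    linarith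
  · rw [mean_eq_deriv, mean_eq_deriv]
    have := (abs_le.1 (key _ hbp _ hbt)).1
    rw [show t + ε * δ - t = ε * δ by ring, abs_of_pos hεδ] at this
    simp only
    linarith
  · set x0 := t - δ with hx0
    set x1 := t + ε * δ with hx1
    rw [kl, mean_eq_deriv, ← F.cgf_eq (hball hbm).2, ← F.cgf_eq (hball hbp).2]
    change (x0 - x1) * m x0 - cgf id F.ξ x0 + cgf id F.ξ x1 ≤ _
    have hsub : Set.Icc x0 x1 ⊆ Metric.ball t r :=
      (convex_ball t r).ordConnected.out hbm hbp
    have hx01 : x0 ≤ x1 := by linarith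
    -- The divergence is the Bregman divergence of the cumulant generating function, so the bound on
    -- it is exactly `g x1 ≤ g x0`.
    let g : ℝ → ℝ := fun x => cgf id F.ξ x - x * m x0 - (1 + ε) * v * (x - x0) ^ 2 / 2
    have hd : ∀ x ∈ Metric.ball t r,
        HasDerivAt g (m x - m x0 - (1 + ε) * v * (x - x0)) x := by
      intro x hx
      have e1 : HasDerivAt (cgf id F.ξ) (m x) x :=
        (F.analyticAt_cgf (hball hx).2).differentiableAt.hasDerivAt
      have e2 : HasDerivAt (fun x : ℝ => x * m x0) (m x0) x := by
        simpa using (hasDerivAt_id x).mul_const (m x0)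
      have e3 : HasDerivAt (fun x : ℝ => (1 + ε) * v * (x - x0) ^ 2 / 2)
          ((1 + ε) * v * (x - x0)) x := by
        have := ((((hasDerivAt_id x).sub_const x0).pow 2).const_mul ((1 + ε) * v)).div_const 2
        refine this.congr_deriv ?_
        simp; ring
      exact (e1.sub e2).sub e3
    have hanti : AntitoneOn g (Set.Icc x0 x1) := by
      refine antitoneOn_of_deriv_nonpos (convex_Icc _ _)
        (fun x hx => (hd x (hsub hx)).continuousAt.continuousWithinAt)
        (fun x hx => (hd x (hsub (interior_subset hx))).differentiableAt.differentiableWithinAt)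
        fun x hx => ?_
      have hx' := interior_subset hx
      rw [(hd x (hsub hx')).deriv]
      have := (abs_le.1 (key _ (hsub hx') _ hbm)).2
      rw [abs_of_nonneg (sub_nonneg.2 hx'.1)] at this
      linarith
    have := hanti (Set.left_mem_Icc.2 hx01) (Set.right_mem_Icc.2 hx01) hx01
    simp only [g] at this
    have h3 : x1 - x0 = (1 + ε) * δ := by rw [hx0, hx1]; ring
    rw [h3, sub_self] at this
    linarith

end ExpFamily

/-! ### Stopping times of an i.i.d. sequence: change of measure, Wald, information inequality -/

section Stopping

variable {α : Type*} [MeasurableSpace α]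

/-- Filling the coordinates outside `s` with a fixed point gives a measurable section of the
restriction map. -/
lemma exists_restrict_preimage_eq [Nonempty α] (s : Finset ℕ) {A : Set (ℕ → α)}
    (hA : MeasurableSet A) (hdep : ∀ y y', (∀ i ∈ s, y i = y' i) → y ∈ A → y' ∈ A) :
    ∃ B : Set (s → α), MeasurableSet B ∧ A = s.restrict ⁻¹' B := by
  obtain ⟨x⟩ := ‹Nonempty α›
  refine ⟨(fun z => Function.updateFinset (fun _ => x) s z) ⁻¹' A,
    measurable_updateFinset hA, Set.ext fun y => ?_⟩
  constructor
  · exact hdep _ _ fun i hi => by simp [Function.updateFinset, hi]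
  · exact hdep _ _ fun i hi => by simp [Function.updateFinset, hi]

/-- Changing the law of finitely many coordinates of an i.i.d. sequence multiplies the density. -/
lemma infinitePi_ite_withDensity (μ : Measure α) [IsProbabilityMeasure μ] {r : α → ℝ≥0∞}
    (hr : Measurable r) [IsProbabilityMeasure (μ.withDensity r)] (S : Finset ℕ)
    [∀ i, IsProbabilityMeasure (if i ∈ S then μ.withDensity r else μ)] :
    (Measure.infinitePi fun _ : ℕ => μ).withDensity (fun y => ∏ i ∈ S, r (y i)) =
      Measure.infinitePi fun i : ℕ => if i ∈ S then μ.withDensity r else μ := by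
  refine Measure.eq_infinitePi _ fun I t ht => ?_
  have hbox : MeasurableSet (Set.pi (I : Set ℕ) t) := .pi I.countable_toSet fun i _ => ht i
  -- One factor per coordinate, combining the side of the box and the density, so that independence
  -- factorizes the integral; coordinates in `S` but not in `I` contribute ∫ r dμ = 1.
  let X : ℕ → α → ℝ≥0∞ := fun i x =>
    (if i ∈ I then (t i).indicator 1 x else 1) * (if i ∈ S then r x else 1)
  have hX : ∀ i, Measurable (X i) := by
    intro i
    refine Measurable.mul ?_ ?_
    · split_ifs
      · exact measurable_one.indicator (ht i)
      · exact measurable_const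
    · split_ifs
      · exact hr
      · exact measurable_const
  have hprod : ∀ y : ℕ → α, (Set.pi (I : Set ℕ) t).indicator (fun y => ∏ i ∈ S, r (y i)) y =
      ∏ i ∈ I ∪ S, X i (y i) := by
    intro y
    simp only [X, Finset.prod_mul_distrib]
    rw [Finset.prod_ite_mem, Finset.prod_ite_mem, Finset.union_inter_cancel_left,
      Finset.union_inter_cancel_right]
    by_cases hy : y ∈ Set.pi (I : Set ℕ) t
    · have h1 : ∏ i ∈ I, (t i).indicator (1 : α → ℝ≥0∞) (y i) = 1 :=
        Finset.prod_eq_one fun i hi => by simp [Set.indicator_of_mem (hy i hi)]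
      rw [Set.indicator_of_mem hy, h1, one_mul]
    · rw [Set.indicator_of_notMem hy]
      simp only [Set.mem_pi, not_forall] at hy
      obtain ⟨i, hi, hn⟩ := hy
      rw [Finset.prod_eq_zero hi (by simp [hn]), zero_mul]
  rw [withDensity_apply _ hbox, ← lintegral_indicator hbox, lintegral_congr hprod,
    lintegral_prod_eq_prod_lintegral_of_indepFun _ _
      (iIndepFun_infinitePi (P := fun _ : ℕ => μ) hX) fun i => (hX i).comp (measurable_pi_apply i)]
  have heval : ∀ i, ∫⁻ y, X i (y i) ∂(Measure.infinitePi fun _ : ℕ => μ) = ∫⁻ x, X i x ∂μ :=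
    fun i => (measurePreserving_eval_infinitePi (fun _ : ℕ => μ) i).lintegral_comp (hX i)
  simp only [heval]
  rw [← Finset.prod_subset Finset.subset_union_left]
  · refine Finset.prod_congr rfl fun i hi => ?_
    by_cases hS : i ∈ S
    · simp only [X, hi, hS, if_true]
      rw [withDensity_apply _ (ht i), ← lintegral_indicator (ht i)]
      refine lintegral_congr fun x => ?_
      by_cases hx : x ∈ t i <;> simp [hx]
    · simp only [X, hi, hS, if_true, if_false, mul_one]
      rw [lintegral_indicator_one (ht i)]
  · intro i hi hI
    have hS : i ∈ S := by simpa [hI] using hi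
    simp only [X, hI, hS, if_true, if_false, one_mul]
    rw [← setLIntegral_univ, ← withDensity_apply _ .univ, measure_univ]

/-- Two infinite product measures may be mutually singular. Since `A` sees only `S`, the law of the
other coordinates can be left equal to `μ`, which makes the density a finite product. -/
lemma infinitePi_withDensity_apply_of_dependsOn (μ : Measure α) [IsProbabilityMeasure μ]
    {r : α → ℝ≥0∞} (hr : Measurable r) [IsProbabilityMeasure (μ.withDensity r)] (S : Finset ℕ)
    {A : Set (ℕ → α)} (hA : MeasurableSet A)
    (hdep : ∀ y y', (∀ i ∈ S, y i = y' i) → y ∈ A → y' ∈ A) :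
    Measure.infinitePi (fun _ : ℕ => μ.withDensity r) A =
      ∫⁻ y in A, ∏ i ∈ S, r (y i) ∂(Measure.infinitePi fun _ : ℕ => μ) := by
  have : Nonempty α := nonempty_of_isProbabilityMeasure μ
  have : ∀ i, IsProbabilityMeasure (if i ∈ S then μ.withDensity r else μ) := by
    intro i; split_ifs <;> infer_instance
  obtain ⟨B, hB, rfl⟩ := exists_restrict_preimage_eq S hA hdep
  rw [← withDensity_apply _ hA, infinitePi_ite_withDensity μ hr,
    ← Measure.map_apply (Finset.measurable_restrict S) hB,
    ← Measure.map_apply (Finset.measurable_restrict S) hB, Measure.infinitePi_map_restrict,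
    Measure.infinitePi_map_restrict]
  congr 2
  ext1 i
  simp [i.2]

/-- Change of measure up to a stopping time. -/
lemma lintegral_infinitePi_withDensity_stopping (μ : Measure α) [IsProbabilityMeasure μ]
    {r : α → ℝ≥0∞} (hr : Measurable r) [IsProbabilityMeasure (μ.withDensity r)]
    {τ : (ℕ → α) → ℕ} (hτ : Measurable τ)
    (hadapt : ∀ y y', (∀ s < τ y, y s = y' s) → τ y' = τ y) (φ : ℕ → ℝ≥0∞) :
    ∫⁻ y, φ (τ y) ∂(Measure.infinitePi fun _ : ℕ => μ.withDensity r) =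
      ∫⁻ y, φ (τ y) * ∏ s ∈ Finset.range (τ y), r (y s) ∂(Measure.infinitePi fun _ : ℕ => μ) := by
  -- The space is cut into the events τ = n; by `hadapt` each depends on the first n coordinates
  -- only, so the finite change of measure applies to it.
  have hA : ∀ n, MeasurableSet (τ ⁻¹' {n}) := fun n => hτ (measurableSet_singleton n)
  have hU : (⋃ n, τ ⁻¹' {n}) = Set.univ := by ext y; simp
  have hdisj : Pairwise (Function.onFun Disjoint fun n => τ ⁻¹' {n}) := fun m n hmn =>
    Disjoint.preimage τ (by simpa using hmn)
  rw [← setLIntegral_univ, ← hU, lintegral_iUnion hA hdisj,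
    ← setLIntegral_univ (μ := Measure.infinitePi fun _ : ℕ => μ), ← hU,
    lintegral_iUnion hA hdisj]
  refine tsum_congr fun n => ?_
  have h1 : ∫⁻ y in τ ⁻¹' {n}, φ (τ y) ∂(Measure.infinitePi fun _ : ℕ => μ.withDensity r) =
      ∫⁻ y in τ ⁻¹' {n}, φ n ∂(Measure.infinitePi fun _ : ℕ => μ.withDensity r) :=
    setLIntegral_congr_fun (hA n) fun y hy => by
      simp only [Set.mem_preimage, Set.mem_singleton_iff] at hy
      simp only [hy]
  have h2 : ∫⁻ y in τ ⁻¹' {n}, φ (τ y) * ∏ s ∈ Finset.range (τ y), r (y s)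
        ∂(Measure.infinitePi fun _ : ℕ => μ) =
      ∫⁻ y in τ ⁻¹' {n}, φ n * ∏ s ∈ Finset.range n, r (y s)
        ∂(Measure.infinitePi fun _ : ℕ => μ) :=
    setLIntegral_congr_fun (hA n) fun y hy => by
      simp only [Set.mem_preimage, Set.mem_singleton_iff] at hy
      simp only [hy]
  rw [h1, h2, lintegral_const_mul _ (by fun_prop), setLIntegral_const,
    infinitePi_withDensity_apply_of_dependsOn μ hr (Finset.range n) (hA n)]
  intro y y' hyy hy
  simp only [Set.mem_preimage, Set.mem_singleton_iff] at hy ⊢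
  rw [hadapt y y' fun s hs => hyy s (Finset.mem_range.2 (hy ▸ hs)), hy]

/-- Wald's identity for a bounded stopping time, where `{s < τ}` depends on the first `s`
coordinates. -/
lemma integral_sum_range_stopping (μ : Measure α) [IsProbabilityMeasure μ] {f : α → ℝ}
    (hf : Integrable f μ) {τ : (ℕ → α) → ℕ} (hτ : Measurable τ)
    (hadapt : ∀ y y', (∀ s < τ y, y s = y' s) → τ y' = τ y) {T : ℕ} (hT : ∀ y, τ y ≤ T) :
    Integrable (fun y => ∑ s ∈ Finset.range (τ y), f (y s)) (Measure.infinitePi fun _ : ℕ => μ) ∧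
    ∫ y, ∑ s ∈ Finset.range (τ y), f (y s) ∂(Measure.infinitePi fun _ : ℕ => μ) =
      (∫ y, (τ y : ℝ) ∂(Measure.infinitePi fun _ : ℕ => μ)) * ∫ x, f x ∂μ := by
  have : Nonempty α := nonempty_of_isProbabilityMeasure μ
  set P := Measure.infinitePi fun _ : ℕ => μ with hP
  have hA : ∀ s, MeasurableSet {y | s < τ y} := fun s => hτ measurableSet_Ioi
  have hsum : ∀ y, ∀ g : ℕ → ℝ, ∑ s ∈ Finset.range (τ y), g s =
      ∑ s ∈ Finset.range T, {y | s < τ y}.indicator (1 : (ℕ → α) → ℝ) y * g s := by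
    intro y g
    simp only [Set.indicator_apply, Set.mem_ofPred_eq, Pi.one_apply, ite_mul, one_mul, zero_mul]
    rw [← Finset.sum_filter]
    refine Finset.sum_congr (Finset.ext fun s => ?_) fun _ _ => rfl
    have := hT y
    simp only [Finset.mem_range, Finset.mem_filter]
    omega
  have hi1 : ∀ s, Integrable ({y | s < τ y}.indicator (1 : (ℕ → α) → ℝ)) P :=
    fun s => (integrable_const (1 : ℝ)).indicator (hA s)
  have hfs : ∀ s : ℕ, Integrable (fun y : ℕ → α => f (y s)) P := fun s =>
    (measurePreserving_eval_infinitePi (fun _ : ℕ => μ) s).integrable_comp_of_integrable hf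
  have hfi : ∀ s : ℕ, ∫ y, f (y s) ∂P = ∫ x, f x ∂μ := fun s => by
    have h := measurePreserving_eval_infinitePi (fun _ : ℕ => μ) s
    rw [← h.map_eq, integral_map h.aemeasurable (by rw [h.map_eq]; exact hf.1)]
  have hind : ∀ s, IndepFun ({y | s < τ y}.indicator (1 : (ℕ → α) → ℝ))
      (fun y : ℕ → α => f (y s)) P := by
    intro s
    obtain ⟨B, hB, hBA⟩ := exists_restrict_preimage_eq (Finset.range s) (hA s)
      (fun y y' hyy hy => by
        -- If the second sequence stopped by time s, it would agree with the first up to its own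
        -- stopping time, and both would stop together.
        by_contra hn
        simp only [Set.mem_ofPred_eq, not_lt] at hy hn
        have := hadapt y' y fun i hi => (hyy i (Finset.mem_range.2 (hi.trans_le hn))).symm
        omega)
    have h0 := (iIndepFun_infinitePi (P := fun _ : ℕ => μ) (X := fun _ => id)
      fun _ => measurable_id).indepFun_finset (Finset.range s) {s} (by simp)
      (fun i => measurable_pi_apply i)
    have h1 : IndepFun (fun y : ℕ → α => (Finset.range s).restrict y) (fun y : ℕ → α => y s) P :=
      h0.comp (φ := fun z : Finset.range s → α => z)
        (ψ := fun z : ({s} : Finset ℕ) → α => z ⟨s, by simp⟩) measurable_id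
        (measurable_pi_apply (⟨s, by simp⟩ : ({s} : Finset ℕ)))
    have h2 : IndepFun
        (fun y : ℕ → α => B.indicator (1 : (Finset.range s → α) → ℝ) ((Finset.range s).restrict y))
        (fun y : ℕ → α => f (y s)) P := by
      have hf' : AEMeasurable f (P.map fun y : ℕ → α => y s) := by
        have h := measurePreserving_eval_infinitePi (fun _ : ℕ => μ) s
        change AEMeasurable f (P.map (Function.eval s))
        rw [h.map_eq]
        exact hf.1.aemeasurable
      exact h1.comp₀ (φ := B.indicator (1 : (Finset.range s → α) → ℝ))
        (Finset.measurable_restrict _).aemeasurable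
        (measurable_pi_apply s).aemeasurable (measurable_one.indicator hB).aemeasurable hf'
    rw [hBA]
    exact h2
  have hi2 : ∀ s, Integrable (fun y => {y | s < τ y}.indicator (1 : (ℕ → α) → ℝ) y * f (y s)) P :=
    fun s => (hind s).integrable_mul (hi1 s) (hfs s)
  have hcount : ∀ y, (τ y : ℝ) =
      ∑ s ∈ Finset.range T, {y | s < τ y}.indicator (1 : (ℕ → α) → ℝ) y := by
    intro y
    have := hsum y fun _ => 1
    simpa using this
  constructor
  · simp only [hsum]
    exact integrable_finsetSum _ fun s _ => hi2 s
  · simp only [hsum _ (fun s => f _)]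
    rw [integral_finsetSum _ fun s _ => hi2 s]
    simp only [hcount]
    rw [integral_finsetSum _ fun s _ => hi1 s, Finset.sum_mul]
    refine Finset.sum_congr rfl fun s _ => ?_
    rw [(hind s).integral_fun_mul_eq_mul_integral (hi1 s).1 (hfs s).1, hfi]

/-- The information inequality behind the regret bound, for a single i.i.d. sequence: if the
stopping time is short under `μ`, then it is also short under `exp (-ℓ) μ`. -/
lemma le_add_lintegral_stopping (μ : Measure α) [IsProbabilityMeasure μ] {ℓ : α → ℝ}
    (hℓm : Measurable ℓ) (hℓ : Integrable ℓ μ)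
    [IsProbabilityMeasure (μ.withDensity fun x => ENNReal.ofReal (Real.exp (-ℓ x)))]
    {τ : (ℕ → α) → ℕ} (hτ : Measurable τ)
    (hadapt : ∀ y y', (∀ s < τ y, y s = y' s) → τ y' = τ y) {T : ℕ} (hT : ∀ y, τ y ≤ T)
    (hT0 : 0 < T) {D c : ℝ} (hD0 : 0 ≤ D) (hD : ∫ x, ℓ x ∂μ ≤ D) (hc : 0 ≤ c) :
    ENNReal.ofReal c ≤
      ENNReal.ofReal (Real.exp c / T) * ∫⁻ y, ((T - τ y : ℕ) : ℝ≥0∞)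
          ∂(Measure.infinitePi fun _ : ℕ =>
            μ.withDensity fun x => ENNReal.ofReal (Real.exp (-ℓ x))) +
        ENNReal.ofReal (D + c / T) *
          ∫⁻ y, (τ y : ℝ≥0∞) ∂(Measure.infinitePi fun _ : ℕ => μ) := by
  set ν := μ.withDensity fun x => ENNReal.ofReal (Real.exp (-ℓ x)) with hν
  set P := Measure.infinitePi fun _ : ℕ => μ with hP
  set Q := Measure.infinitePi fun _ : ℕ => ν with hQ
  have hT1 : (0 : ℝ) < T := by exact_mod_cast hT0
  -- With z = n / T, this dominates the convex combination e^c (1 - z) + z.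
  let w : ℕ → ℝ := fun n => Real.exp c / T * (T - n : ℕ) + 1
  let L : (ℕ → α) → ℝ := fun y => ∑ s ∈ Finset.range (τ y), ℓ (y s)
  have hw : ∀ n, 0 ≤ w n := fun n => by positivity
  obtain ⟨hLi, hL⟩ := integral_sum_range_stopping μ hℓ hτ hadapt hT
  change Integrable L P at hLi
  change ∫ y, L y ∂P = _ at hL
  have hτi : Integrable (fun y => (τ y : ℝ)) P :=
    Integrable.of_bound (by fun_prop) (C := (T : ℝ)) (ae_of_all _ fun y => by
      simpa using hT y)
  have hchange : ∫⁻ y, ENNReal.ofReal (w (τ y)) ∂Q =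
      ∫⁻ y, ENNReal.ofReal (w (τ y) * Real.exp (-L y)) ∂P := by
    rw [hQ, hν, lintegral_infinitePi_withDensity_stopping μ (by fun_prop) hτ hadapt
      fun n => ENNReal.ofReal (w n)]
    refine lintegral_congr fun y => ?_
    rw [ENNReal.ofReal_mul (hw _), ← ENNReal.ofReal_prod_of_nonneg fun _ _ => (Real.exp_pos _).le,
      ← Real.exp_sum, Finset.sum_neg_distrib]
  -- The inequality 1 + x ≤ e^x is used at x = c - L with weight 1 - z and at x = -L with weight z,
  -- where z = τ / T. Integrating the result needs only Wald's identity for the mean of L, and no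
  -- concentration estimate.
  have hpt : ∀ y, 1 + c * (1 - τ y / T) - L y ≤ w (τ y) * Real.exp (-L y) := by
    intro y
    have hz0 : 0 ≤ (τ y : ℝ) / T := by positivity
    have hz1 : (τ y : ℝ) / T ≤ 1 := by
      rw [div_le_one hT1]; exact_mod_cast hT y
    have hwz : Real.exp c * (1 - τ y / T) + τ y / T ≤ w (τ y) := by
      simp only [w]
      rw [Nat.cast_sub (hT y)]
      have : Real.exp c / T * ((T : ℝ) - τ y) = Real.exp c * (1 - τ y / T) := by
        field_simp
      rw [this]
      linarith
    have e1 : 1 + c - L y ≤ Real.exp c * Real.exp (-L y) := by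
      rw [← Real.exp_add]
      have := Real.add_one_le_exp (c + -L y)
      linarith
    have e2 : 1 - L y ≤ Real.exp (-L y) := by
      have := Real.add_one_le_exp (-L y)
      linarith
    refine le_trans ?_ (mul_le_mul_of_nonneg_right hwz (Real.exp_pos _).le)
    have h1 := mul_le_mul_of_nonneg_left e1 (sub_nonneg.2 hz1)
    have h2 := mul_le_mul_of_nonneg_left e2 hz0
    linarith
  have hi : Integrable (fun y => 1 + c * (1 - τ y / T) - L y) P :=
    ((integrable_const 1).add (((integrable_const 1).sub (hτi.div_const _)).const_mul c)).sub hLi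
  have hint : ∫ y, (1 + c * (1 - τ y / T) - L y) ∂P =
      1 + c - (c / T + ∫ x, ℓ x ∂μ) * ∫ y, (τ y : ℝ) ∂P := by
    have h1 : ∀ y, 1 + c * (1 - τ y / T) - L y = (1 + c) - (c / T) * τ y - L y := fun y => by ring
    simp only [h1]
    have h2 := integral_sub ((integrable_const (1 + c)).sub (hτi.const_mul (c / T))) hLi
    have h3 := integral_sub (integrable_const (μ := P) (1 + c)) (hτi.const_mul (c / T))
    simp only [Pi.sub_apply] at h2 h3
    rw [h2, h3, hL, integral_const_mul]
    simp
    ring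
  have hτe : ∫⁻ y, (τ y : ℝ≥0∞) ∂P = ENNReal.ofReal (∫ y, (τ y : ℝ) ∂P) := by
    rw [ofReal_integral_eq_lintegral_ofReal hτi (ae_of_all _ fun y => by positivity)]
    simp
  have hwq : ∫⁻ y, ENNReal.ofReal (w (τ y)) ∂Q =
      ENNReal.ofReal (Real.exp c / T) * (∫⁻ y, ((T - τ y : ℕ) : ℝ≥0∞) ∂Q) + 1 := by
    rw [← lintegral_const_mul _ (by fun_prop)]
    have : (1 : ℝ≥0∞) = ∫⁻ _, 1 ∂Q := by simp
    rw [this, ← lintegral_add_right _ measurable_const]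
    refine lintegral_congr fun y => ?_
    simp only [w]
    rw [ENNReal.ofReal_add (by positivity) zero_le_one, ENNReal.ofReal_mul (by positivity)]
    simp
  have hmain : ENNReal.ofReal (1 + c - (c / T + ∫ x, ℓ x ∂μ) * ∫ y, (τ y : ℝ) ∂P) ≤
      ENNReal.ofReal (Real.exp c / T) * (∫⁻ y, ((T - τ y : ℕ) : ℝ≥0∞) ∂Q) + 1 := by
    rw [← hwq, hchange, ← hint]
    refine le_trans ?_ (lintegral_mono fun y => ENNReal.ofReal_le_ofReal (hpt y))
    rw [integral_eq_lintegral_pos_part_sub_lintegral_neg_part hi]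
    exact (ENNReal.ofReal_le_ofReal (sub_le_self _ ENNReal.toReal_nonneg)).trans
      ENNReal.ofReal_toReal_le
  have hτ0 : 0 ≤ ∫ y, (τ y : ℝ) ∂P := integral_nonneg fun y => by positivity
  rw [hτe, ← ENNReal.ofReal_mul (by positivity)]
  refine (ENNReal.add_le_add_iff_right (a := 1) ENNReal.one_ne_top).1 ?_
  calc ENNReal.ofReal c + 1 = ENNReal.ofReal (1 + c) := by
        rw [ENNReal.ofReal_add zero_le_one hc, ENNReal.ofReal_one, add_comm]
    _ ≤ ENNReal.ofReal ((1 + c - (c / T + ∫ x, ℓ x ∂μ) * ∫ y, (τ y : ℝ) ∂P) +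
          (D + c / T) * ∫ y, (τ y : ℝ) ∂P) := by
        refine ENNReal.ofReal_le_ofReal ?_
        have := mul_le_mul_of_nonneg_right hD hτ0
        linarith
    _ ≤ _ + _ := ENNReal.ofReal_add_le
    _ ≤ (ENNReal.ofReal (Real.exp c / T) * (∫⁻ y, ((T - τ y : ℕ) : ℝ≥0∞) ∂Q) + 1) +
          ENNReal.ofReal ((D + c / T) * ∫ y, (τ y : ℝ) ∂P) := by gcongr
    _ = _ := by ring

end Stopping

/-! ### Isolating one coordinate of a product measure -/

section PiSplit

variable {K : ℕ} {X : Type*}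

/-- The family with value `x` at `a` and values `r` at the other indices. -/
def insertAt (a : Fin K) (x : X) (r : {i : Fin K // i ≠ a} → X) (i : Fin K) : X :=
  if hi : i ≠ a then r ⟨i, hi⟩ else x

@[simp] lemma insertAt_self (a : Fin K) (x : X) (r : {i : Fin K // i ≠ a} → X) :
    insertAt a x r a = x := by simp [insertAt]

@[simp] lemma insertAt_coe (a : Fin K) (x : X) (r : {i : Fin K // i ≠ a} → X)
    (i : {i : Fin K // i ≠ a}) : insertAt a x r i = r i := by simp [insertAt, i.2]

lemma insertAt_of_ne (a : Fin K) (x : X) (r : {i : Fin K // i ≠ a} → X) {i : Fin K} (hi : i ≠ a) :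
    insertAt a x r i = r ⟨i, hi⟩ := by simp [insertAt, hi]

variable [MeasurableSpace X]

lemma measurable_insertAt (a : Fin K) :
    Measurable fun p : X × ({i : Fin K // i ≠ a} → X) => insertAt a p.1 p.2 := by
  refine measurable_pi_lambda _ fun i => ?_
  by_cases hi : i = a
  · subst hi; simpa using measurable_fst
  · simp only [insertAt_of_ne a _ _ hi]
    fun_prop

lemma pi_eq_map_insertAt (μ : Fin K → Measure X) [∀ i, IsProbabilityMeasure (μ i)] (a : Fin K) :
    Measure.pi μ = ((μ a).prod (Measure.pi fun i : {i : Fin K // i ≠ a} => μ i)).map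
      fun p => insertAt a p.1 p.2 := by
  refine Measure.pi_eq fun s hs => ?_
  rw [Measure.map_apply (measurable_insertAt a) (.univ_pi hs)]
  have : (fun p : X × ({i : Fin K // i ≠ a} → X) => insertAt a p.1 p.2) ⁻¹' Set.univ.pi s =
      s a ×ˢ Set.univ.pi fun i : {i : Fin K // i ≠ a} => s i := by
    ext p
    simp only [Set.mem_preimage, Set.mem_univ_pi, Set.mem_prod]
    constructor
    · intro h
      exact ⟨by simpa using h a, fun i => by simpa using h i⟩
    · rintro ⟨h1, h2⟩ i
      by_cases hi : i = a
      · subst hi; simpa using h1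
      · simpa [insertAt_of_ne a _ _ hi] using h2 ⟨i, hi⟩
  rw [this, Measure.prod_prod, Measure.pi_pi,
    Fintype.prod_eq_mul_prod_subtype_ne (fun i => μ i (s i)) a]

lemma lintegral_pi_insertAt (μ : Fin K → Measure X) [∀ i, IsProbabilityMeasure (μ i)] (a : Fin K)
    {f : (Fin K → X) → ℝ≥0∞} (hf : Measurable f) :
    ∫⁻ x, f x ∂Measure.pi μ =
      ∫⁻ r, ∫⁻ x, f (insertAt a x r) ∂μ a ∂Measure.pi fun i : {i : Fin K // i ≠ a} => μ i := by
  have hm : Measurable fun p : X × ({i : Fin K // i ≠ a} → X) => f (insertAt a p.1 p.2) :=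
    hf.comp (measurable_insertAt a)
  rw [pi_eq_map_insertAt μ a, lintegral_map hf (measurable_insertAt a),
    lintegral_prod_symm _ hm.aemeasurable]

end PiSplit

/-! ### Histories and numbers of draws -/

namespace Strategy

variable {K : ℕ} (𝒜 : Strategy K)

lemma history_fst (ω : Outcome K) (t : ℕ) (s : Fin t) : (𝒜.history ω t s).1 = 𝒜.arm ω s := by
  induction t with
  | zero => exact s.elim0
  | succ t ih =>
    refine Fin.lastCases ?_ (fun s => ?_) s
    · simp [history, arm]
    · simp [history, ih s]

/-- The number of draws of arm `a` in the first `t` rounds. -/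
def pulls (a : Fin K) (t : ℕ) (ω : Outcome K) : ℕ :=
  ((Finset.range t).filter fun s => 𝒜.arm ω s = a).card

lemma pulls_le (a : Fin K) (t : ℕ) (ω : Outcome K) : 𝒜.pulls a t ω ≤ t := by
  exact (Finset.card_filter_le _ _).trans (Finset.card_range t).le

lemma pulls_mono (a : Fin K) (ω : Outcome K) : Monotone fun t => 𝒜.pulls a t ω := fun _ _ h =>
  Finset.card_le_card (Finset.filter_subset_filter _ (Finset.range_mono h))

lemma pulls_succ (a : Fin K) (t : ℕ) (ω : Outcome K) :
    𝒜.pulls a (t + 1) ω = 𝒜.pulls a t ω + if 𝒜.arm ω t = a then 1 else 0 := by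
  simp only [pulls, Finset.range_add_one, Finset.filter_insert]
  split_ifs with h
  · rw [Finset.card_insert_of_notMem (by simp)]
  · rfl

lemma card_history (a : Fin K) (t : ℕ) (ω : Outcome K) :
    (Finset.univ.filter fun s : Fin t => (𝒜.history ω t s).1 = a).card = 𝒜.pulls a t ω := by
  simp only [history_fst, pulls, Finset.card_filter]
  exact Fin.sum_univ_eq_sum_range (fun s => if 𝒜.arm ω s = a then 1 else 0) t

lemma history_succ (ω : Outcome K) (t : ℕ) :
    𝒜.history ω (t + 1) = Fin.snoc (α := fun _ => Fin K × ℝ) (𝒜.history ω t)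
      (𝒜.arm ω t, ω.2 (𝒜.arm ω t) (𝒜.pulls (𝒜.arm ω t) t ω)) := by
  rw [← card_history]
  rfl

/-- Two outcomes that differ only in rewards of arm `a` that are never collected lead to the same
history. -/
lemma history_congr {ω ω' : Outcome K} {a : Fin K} {T : ℕ} (h1 : ω.1 = ω'.1)
    (h2 : ∀ b ≠ a, ω.2 b = ω'.2 b) (h3 : ∀ s < 𝒜.pulls a T ω, ω.2 a s = ω'.2 a s) :
    ∀ t ≤ T, 𝒜.history ω t = 𝒜.history ω' t ∧ 𝒜.pulls a t ω = 𝒜.pulls a t ω' := by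
  intro t
  induction t with
  | zero => exact fun _ => ⟨funext fun s => s.elim0, by simp [pulls]⟩
  | succ t ih =>
    intro ht
    obtain ⟨ih1, ih2⟩ := ih (by omega)
    have harm : 𝒜.arm ω t = 𝒜.arm ω' t := by simp only [arm, ih1, h1]
    have hp : ∀ b, 𝒜.pulls b t ω = 𝒜.pulls b t ω' := fun b => by
      rw [← card_history, ← card_history, ih1]
    refine ⟨?_, by rw [pulls_succ, pulls_succ, ih2, harm]⟩
    rw [history_succ, history_succ, ih1, ← harm, ← hp]
    congr 2
    by_cases hb : 𝒜.arm ω t = a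
    · rw [hb]
      -- Rewards are indexed from 0: the one collected now has index `pulls a t`, which is below
      -- `pulls a (t + 1)` and hence below `pulls a T`.
      refine h3 _ (lt_of_lt_of_le ?_ (𝒜.pulls_mono a ω ht))
      simp only [pulls_succ, hb, if_true]
      omega
    · rw [h2 _ hb]

lemma measurable_reward : Measurable fun p : (Fin K → ℕ → ℝ) × Fin K × ℕ => p.1 p.2.1 p.2.2 :=
  measurable_from_prod_countable_left fun q =>
    (measurable_pi_apply q.2).comp (measurable_pi_apply q.1)

lemma measurable_card_history (t : ℕ) :
    Measurable fun p : (Fin t → Fin K × ℝ) × Fin K =>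
      (Finset.univ.filter fun s : Fin t => (p.1 s).1 = p.2).card := by
  simp only [Finset.card_filter]
  refine Finset.measurable_fun_sum _ fun s _ => ?_
  refine Measurable.ite ?_ measurable_const measurable_const
  exact measurableSet_eq_fun (by fun_prop) (by fun_prop)

lemma measurable_history (t : ℕ) : Measurable fun ω => 𝒜.history ω t := by
  induction t with
  | zero => exact measurable_pi_lambda _ fun s => s.elim0
  | succ t ih =>
    have ha : Measurable fun ω : Outcome K => 𝒜.arm ω t :=
      (𝒜.measurable_select t).comp (ih.prodMk ((measurable_pi_apply t).comp measurable_fst))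
    have hn : Measurable fun ω : Outcome K => 𝒜.pulls (𝒜.arm ω t) t ω := by
      simp only [← card_history]
      exact (measurable_card_history t).comp (ih.prodMk ha)
    have hr : Measurable fun ω : Outcome K =>
        ω.2 (𝒜.arm ω t) (𝒜.pulls (𝒜.arm ω t) t ω) :=
      measurable_reward.comp (measurable_snd.prodMk (ha.prodMk hn))
    simp only [history_succ]
    refine measurable_pi_lambda _ fun s => ?_
    refine Fin.lastCases ?_ (fun s => ?_) s
    · simpa using ha.prodMk hr
    · simp only [Fin.snoc_castSucc]
      exact (measurable_pi_apply s).comp ih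

lemma measurable_arm (t : ℕ) : Measurable fun ω => 𝒜.arm ω t :=
  (𝒜.measurable_select t).comp
    ((𝒜.measurable_history t).prodMk ((measurable_pi_apply t).comp measurable_fst))

lemma measurable_pulls (a : Fin K) (t : ℕ) : Measurable (𝒜.pulls a t) := by
  unfold pulls
  simp only [Finset.card_filter]
  refine Finset.measurable_fun_sum _ fun s _ => ?_
  exact Measurable.ite ((𝒜.measurable_arm s) (measurableSet_singleton a))
    measurable_const measurable_const

end Strategy

/-! ### The law of the game and the trade-off between two values of one parameter -/

namespace ExpFamily

variable (F : ExpFamily) {K : ℕ}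

instance isProbabilityMeasure_law (θ : Fin K → F.Θ) : IsProbabilityMeasure (F.law θ) := by
  unfold law; infer_instance

lemma measurable_infinitePi_dist :
    Measurable fun x : F.Θ => Measure.infinitePi fun _ : ℕ => F.dist x := by
  refine Measurable.measure_of_isPiSystem_of_isProbabilityMeasure
    generateFrom_squareCylinders.symm
    (isPiSystem_squareCylinders (fun _ => MeasurableSpace.isPiSystem_measurableSet) (by simp)) ?_
  rintro _ ⟨I, t, ht, rfl⟩
  simp only [Set.mem_univ_pi, Set.mem_ofPred_eq] at ht
  simp only [Measure.infinitePi_pi _ fun i _ => ht i]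
  exact Finset.measurable_fun_prod _ fun i _ =>
    (Measure.measurable_coe (ht i)).comp F.measurable_dist

lemma measurable_law : Measurable (F.law (K := K)) := by
  have h1 : Measurable fun θ : Fin K → F.Θ =>
      Measure.pi fun a => Measure.infinitePi fun _ : ℕ => F.dist (θ a) := by
    refine Measurable.measure_of_isPiSystem_of_isProbabilityMeasure generateFrom_pi.symm
      isPiSystem_pi ?_
    rintro _ ⟨t, ht, rfl⟩
    simp only [Set.mem_univ_pi, Set.mem_ofPred_eq] at ht
    simp only [Measure.pi_pi]
    exact Finset.measurable_fun_prod _ fun i _ => (Measure.measurable_coe (ht i)).comp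
      (F.measurable_infinitePi_dist.comp (measurable_pi_apply i))
  refine Measurable.measure_of_isPiSystem_of_isProbabilityMeasure generateFrom_prod.symm
    isPiSystem_prod ?_
  rintro _ ⟨s, hs, t, ht, rfl⟩
  have ht : MeasurableSet t := ht
  simp only [law, Measure.prod_prod]
  exact ((Measure.measurable_coe ht).comp h1).const_mul _

lemma measurable_mean : Measurable F.mean := by
  have h : ContinuousOn (deriv (cgf id F.ξ)) F.Θ := fun x hx =>
    (F.hasStrictDerivAt_deriv_cgf hx).hasDerivAt.continuousAt.continuousWithinAt
  rw [show F.mean = fun θ : F.Θ => deriv (cgf id F.ξ) θ from funext F.mean_eq_deriv]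
  exact (continuousOn_iff_continuous_domRestrict.1 h).measurable

/-- The rewards of arm `a` are integrated innermost: with everything else frozen, the number of
draws of `a` is a stopping time of a single i.i.d. sequence. -/
lemma lintegral_law_insertAt (a : Fin K) (x : F.Θ) (ϑ : {i : Fin K // i ≠ a} → F.Θ)
    {f : Outcome K → ℝ≥0∞} (hf : Measurable f) :
    ∫⁻ ω, f ω ∂F.law (insertAt a x ϑ) =
      ∫⁻ u, ∫⁻ r, ∫⁻ y, f (u, insertAt a y r) ∂(Measure.infinitePi fun _ : ℕ => F.dist x)
        ∂(Measure.pi fun i : {i : Fin K // i ≠ a} => Measure.infinitePi fun _ : ℕ => F.dist (ϑ i))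
        ∂(Measure.infinitePi fun _ : ℕ => (volume : Measure unitInterval)) := by
  rw [law, lintegral_prod _ hf.aemeasurable]
  refine lintegral_congr fun u => ?_
  have hm : Measurable fun z => f (u, z) := hf.comp measurable_prodMk_left
  rw [lintegral_pi_insertAt _ a hm]
  simp

lemma measurable_mk_insertAt (a : Fin K) : Measurable fun q : ((ℕ → unitInterval) ×
    ({i : Fin K // i ≠ a} → ℕ → ℝ)) × (ℕ → ℝ) => ((q.1.1, insertAt a q.2 q.1.2) : Outcome K) :=
  (measurable_fst.comp measurable_fst).prodMk ((measurable_insertAt a).comp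
    (measurable_snd.prodMk (measurable_snd.comp measurable_fst)))

/-- The trade-off between the draws of arm `a` under two values of its parameter, given all the
other random variables. -/
lemma le_add_lintegral_pulls_given (𝒜 : Strategy K) (a : Fin K) (x x' : F.Θ)
    (u : ℕ → unitInterval) (r : {i : Fin K // i ≠ a} → ℕ → ℝ) {T : ℕ} (hT : 0 < T) {D c : ℝ}
    (hD0 : 0 ≤ D) (hD : F.kl x x' ≤ D) (hc : 0 ≤ c) :
    ENNReal.ofReal c ≤
      ENNReal.ofReal (Real.exp c / T) * ∫⁻ y, ((T - 𝒜.pulls a T (u, insertAt a y r) : ℕ) : ℝ≥0∞)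
          ∂(Measure.infinitePi fun _ : ℕ => F.dist x') +
        ENNReal.ofReal (D + c / T) * ∫⁻ y, (𝒜.pulls a T (u, insertAt a y r) : ℝ≥0∞)
          ∂(Measure.infinitePi fun _ : ℕ => F.dist x) := by
  have hpr : IsProbabilityMeasure ((F.dist x).withDensity fun z =>
      ENNReal.ofReal (Real.exp (-F.llr x x' z))) := by
    rw [← F.dist_eq_withDensity]; infer_instance
  have hτ : Measurable fun y : ℕ → ℝ => 𝒜.pulls a T (u, insertAt a y r) :=
    (𝒜.measurable_pulls a T).comp
      ((measurable_mk_insertAt a).comp (measurable_prodMk_left (x := (u, r))))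
  have hadapt : ∀ y y' : ℕ → ℝ, (∀ s < 𝒜.pulls a T (u, insertAt a y r), y s = y' s) →
      𝒜.pulls a T (u, insertAt a y' r) = 𝒜.pulls a T (u, insertAt a y r) := by
    intro y y' hyy
    have hb : ∀ b ≠ a, insertAt a y r b = insertAt a y' r b := fun b hb => by
      rw [insertAt_of_ne a _ _ hb, insertAt_of_ne a _ _ hb]
    have hs : ∀ s < 𝒜.pulls a T (u, insertAt a y r), insertAt a y r a s = insertAt a y' r a s :=
      fun s hs => by rw [insertAt_self, insertAt_self]; exact hyy s hs
    exact ((𝒜.history_congr (ω := (u, insertAt a y r)) (ω' := (u, insertAt a y' r)) (a := a)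
      (T := T) rfl hb hs) T le_rfl).2.symm
  rw [F.dist_eq_withDensity x x']
  exact le_add_lintegral_stopping (F.dist x) (F.measurable_llr x x') (F.integrable_llr x x')
    hτ hadapt (fun y => 𝒜.pulls_le a T _) hT hD0 (by rwa [F.integral_llr]) hc

/-- The trade-off between the draws of arm `a` under two values of its parameter. -/
lemma le_add_lintegral_pulls (𝒜 : Strategy K) (a : Fin K) (x x' : F.Θ)
    (ϑ : {i : Fin K // i ≠ a} → F.Θ) {T : ℕ} (hT : 0 < T) {D c : ℝ} (hD0 : 0 ≤ D)
    (hD : F.kl x x' ≤ D) (hc : 0 ≤ c) :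
    ENNReal.ofReal c ≤
      ENNReal.ofReal (Real.exp c / T) *
          ∫⁻ ω, ((T - 𝒜.pulls a T ω : ℕ) : ℝ≥0∞) ∂F.law (insertAt a x' ϑ) +
        ENNReal.ofReal (D + c / T) * ∫⁻ ω, (𝒜.pulls a T ω : ℝ≥0∞) ∂F.law (insertAt a x ϑ) := by
  have hmeas : ∀ g : ℕ → ℝ≥0∞, Measurable fun ω => g (𝒜.pulls a T ω) := fun g =>
    measurable_from_nat.comp (𝒜.measurable_pulls a T)
  have hmeas2 : ∀ g : ℕ → ℝ≥0∞, ∀ z : F.Θ, Measurable fun q : (ℕ → unitInterval) ×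
      ({i : Fin K // i ≠ a} → ℕ → ℝ) => ∫⁻ y, g (𝒜.pulls a T (q.1, insertAt a y q.2))
        ∂(Measure.infinitePi fun _ : ℕ => F.dist z) := fun g z =>
    Measurable.lintegral_prod_right' ((hmeas g).comp (measurable_mk_insertAt a))
  rw [F.lintegral_law_insertAt a x ϑ (hmeas fun n => (n : ℝ≥0∞)),
    F.lintegral_law_insertAt a x' ϑ (hmeas fun n => ((T - n : ℕ) : ℝ≥0∞))]
  set MU := Measure.infinitePi fun _ : ℕ => (volume : Measure unitInterval)
  set MR := Measure.pi fun i : {i : Fin K // i ≠ a} => Measure.infinitePi fun _ : ℕ => F.dist (ϑ i)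
  have m1 := hmeas2 (fun n => ((T - n : ℕ) : ℝ≥0∞)) x'
  have m2 := hmeas2 (fun n => (n : ℝ≥0∞)) x
  have hpt : ∀ q : (ℕ → unitInterval) × ({i : Fin K // i ≠ a} → ℕ → ℝ), _ := fun q =>
    F.le_add_lintegral_pulls_given 𝒜 a x x' q.1 q.2 hT hD0 hD hc
  have := lintegral_mono (μ := MU.prod MR) hpt
  rw [lintegral_const, measure_univ, mul_one, lintegral_add_left (m1.const_mul _),
    lintegral_const_mul _ m1, lintegral_const_mul _ m2, lintegral_prod _ m1.aemeasurable,
    lintegral_prod _ m2.aemeasurable] at this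
  exact this

/-! ### Decomposition of the regret by arms -/

/-- The expected number of draws of arm `a` in `T` rounds. -/
def expPulls (𝒜 : Strategy K) (T : ℕ) (a : Fin K) (θ : Fin K → F.Θ) : ℝ≥0∞ :=
  ∫⁻ ω, (𝒜.pulls a T ω : ℝ≥0∞) ∂F.law θ

/-- The expected number of draws of the arms other than `a` in `T` rounds. -/
def expMisses (𝒜 : Strategy K) (T : ℕ) (a : Fin K) (θ : Fin K → F.Θ) : ℝ≥0∞ :=
  ∫⁻ ω, ((T - 𝒜.pulls a T ω : ℕ) : ℝ≥0∞) ∂F.law θ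

/-- The cost of one draw of arm `a`. -/
def gap (a : Fin K) (θ : Fin K → F.Θ) : ℝ≥0∞ :=
  ENNReal.ofReal ((⨆ i, F.mean (θ i)) - F.mean (θ a))

/-- The least cost of a draw of another arm when arm `a` is the best one. -/
def lead (a : Fin K) (θ : Fin K → F.Θ) : ℝ≥0∞ :=
  ENNReal.ofReal (F.mean (θ a) - ⨆ i : {i : Fin K // i ≠ a}, F.mean (θ i))

lemma measurable_expPulls (𝒜 : Strategy K) (T : ℕ) (a : Fin K) :
    Measurable (F.expPulls 𝒜 T a) :=
  (Measure.measurable_lintegral (measurable_from_nat.comp (𝒜.measurable_pulls a T))).comp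
    F.measurable_law

lemma measurable_expMisses (𝒜 : Strategy K) (T : ℕ) (a : Fin K) :
    Measurable (F.expMisses 𝒜 T a) :=
  (Measure.measurable_lintegral ((measurable_from_nat (f := fun n => ((T - n : ℕ) : ℝ≥0∞))).comp
    (𝒜.measurable_pulls a T))).comp F.measurable_law

lemma measurable_gap (a : Fin K) : Measurable (F.gap a) := by
  have h : ∀ i : Fin K, Measurable fun θ : Fin K → F.Θ => F.mean (θ i) := fun i =>
    F.measurable_mean.comp (measurable_pi_apply i)
  exact ((Measurable.iSup h).sub (h a)).ennreal_ofReal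

lemma measurable_lead (a : Fin K) : Measurable (F.lead a) := by
  have h : ∀ i : Fin K, Measurable fun θ : Fin K → F.Θ => F.mean (θ i) := fun i =>
    F.measurable_mean.comp (measurable_pi_apply i)
  exact ((h a).sub (Measurable.iSup fun i : {i : Fin K // i ≠ a} => h i)).ennreal_ofReal

lemma regret_eq (𝒜 : Strategy K) (T : ℕ) (θ : Fin K → F.Θ) :
    F.regret 𝒜 T θ = ∑ a, F.gap a θ * F.expPulls 𝒜 T a θ := by
  have hp : ∀ a, Measurable fun ω => (𝒜.pulls a T ω : ℝ≥0∞) := fun a =>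
    measurable_from_nat.comp (𝒜.measurable_pulls a T)
  have hω : ∀ ω, ∑ t ∈ Finset.range T, F.gap (𝒜.arm ω t) θ =
      ∑ a, F.gap a θ * (𝒜.pulls a T ω : ℝ≥0∞) := by
    intro ω
    simp only [Strategy.pulls, Finset.card_filter, Nat.cast_sum, Nat.cast_ite, Nat.cast_one,
      Nat.cast_zero, Finset.mul_sum, mul_ite, mul_one, mul_zero]
    rw [Finset.sum_comm]
    simp
  change ∫⁻ ω, ∑ t ∈ Finset.range T, F.gap (𝒜.arm ω t) θ ∂F.law θ = _
  simp only [hω]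
  rw [lintegral_finsetSum _ fun a _ => (hp a).const_mul _]
  simp only [lintegral_const_mul _ (hp _), expPulls]

lemma measurable_regret (𝒜 : Strategy K) (T : ℕ) : Measurable (F.regret 𝒜 T) := by
  rw [show F.regret 𝒜 T = fun θ => ∑ a, F.gap a θ * F.expPulls 𝒜 T a θ from
    funext (F.regret_eq 𝒜 T)]
  exact Finset.measurable_fun_sum _ fun a _ =>
    (F.measurable_gap a).mul (F.measurable_expPulls 𝒜 T a)

lemma lead_mul_expMisses_le_regret (𝒜 : Strategy K) (T : ℕ) (a : Fin K) (θ : Fin K → F.Θ) :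
    F.lead a θ * F.expMisses 𝒜 T a θ ≤ F.regret 𝒜 T θ := by
  have hm : Measurable fun ω => ((T - 𝒜.pulls a T ω : ℕ) : ℝ≥0∞) :=
    (measurable_from_nat (f := fun n => ((T - n : ℕ) : ℝ≥0∞))).comp (𝒜.measurable_pulls a T)
  rw [expMisses, ← lintegral_const_mul _ hm]
  refine lintegral_mono fun ω => ?_
  have hcount : T - 𝒜.pulls a T ω = ∑ t ∈ Finset.range T, if 𝒜.arm ω t = a then 0 else 1 := by
    have h := Finset.card_filter_add_card_filter_not (s := Finset.range T) fun t => 𝒜.arm ω t = a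
    rw [Finset.card_range] at h
    simp only [Strategy.pulls]
    rw [Nat.sub_eq_of_eq_add' h.symm, Finset.card_filter]
    exact Finset.sum_congr rfl fun t _ => by split_ifs <;> simp_all
  simp only [hcount, Nat.cast_sum, Finset.mul_sum]
  refine Finset.sum_le_sum fun t _ => ?_
  split_ifs with h
  · simp
  · simp only [Nat.cast_one, mul_one]
    refine ENNReal.ofReal_le_ofReal (sub_le_sub ?_ ?_)
    · exact le_ciSup (f := fun i => F.mean (θ i)) (Set.finite_range _).bddAbove a
    · exact le_ciSup (f := fun i : {i : Fin K // i ≠ a} => F.mean (θ i))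
        (Set.finite_range _).bddAbove ⟨_, h⟩

/-- At most one arm strictly beats all the others, so at most one term of the sum is nonzero. -/
lemma sum_lead_mul_expMisses_le_regret (𝒜 : Strategy K) (T : ℕ) (θ : Fin K → F.Θ) :
    ∑ a, F.lead a θ * F.expMisses 𝒜 T a θ ≤ F.regret 𝒜 T θ := by
  by_cases h : ∃ a, F.lead a θ ≠ 0
  · obtain ⟨a, ha⟩ := h
    rw [Finset.sum_eq_single a]
    · exact F.lead_mul_expMisses_le_regret 𝒜 T a θ
    · intro b _ hb
      have h1 : ⨆ i : {i : Fin K // i ≠ a}, F.mean (θ i) < F.mean (θ a) := by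
        simpa [lead] using ha
      have h2 : F.mean (θ b) ≤ ⨆ i : {i : Fin K // i ≠ a}, F.mean (θ i) :=
        le_ciSup (f := fun i : {i : Fin K // i ≠ a} => F.mean (θ i))
          (Set.finite_range _).bddAbove ⟨b, hb⟩
      have h3 : F.mean (θ a) ≤ ⨆ i : {i : Fin K // i ≠ b}, F.mean (θ i) :=
        le_ciSup (f := fun i : {i : Fin K // i ≠ b} => F.mean (θ i))
          (Set.finite_range _).bddAbove ⟨a, hb.symm⟩
      rw [lead, ENNReal.ofReal_of_nonpos (by linarith), zero_mul]
    · simp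
  · push Not at h
    simp [h]

/-- The Bayes risk controls, for all arms together, the cost of the draws of an arm that is not the
best and, with a small weight, the cost of not drawing the best arm. -/
lemma sum_lintegral_le_bayesRisk (𝒜 : Strategy K) (T : ℕ) (H : Measure (Fin K → F.Θ)) (ε : ℝ≥0∞) :
    ∑ a, ∫⁻ θ, (F.gap a θ * F.expPulls 𝒜 T a θ + ε * (F.lead a θ * F.expMisses 𝒜 T a θ)) ∂H ≤
      (1 + ε) * F.bayesRisk H 𝒜 T := by
  have hm : ∀ a, Measurable fun θ : Fin K → F.Θ =>
      F.gap a θ * F.expPulls 𝒜 T a θ + ε * (F.lead a θ * F.expMisses 𝒜 T a θ) := fun a =>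
    ((F.measurable_gap a).mul (F.measurable_expPulls 𝒜 T a)).add
      (((F.measurable_lead a).mul (F.measurable_expMisses 𝒜 T a)).const_mul ε)
  rw [← lintegral_finsetSum _ fun a _ => hm a, bayesRisk,
    ← lintegral_const_mul _ (F.measurable_regret 𝒜 T)]
  refine lintegral_mono fun θ => ?_
  simp only
  rw [Finset.sum_add_distrib, ← Finset.mul_sum, ← F.regret_eq, add_mul, one_mul]
  gcongr
  exact F.sum_lead_mul_expMisses_le_regret 𝒜 T θ

/-! ### The two-point bound around the largest of the other parameters -/

lemma exists_eq_iSup [Nontrivial (Fin K)] (a : Fin K) (ϑ : {i : Fin K // i ≠ a} → F.Θ) :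
    ∃ j, (⨆ i, (ϑ i : ℝ)) = ϑ j ∧ ∀ i, ϑ i ≤ ϑ j := by
  have : Nonempty {i : Fin K // i ≠ a} := nonempty_subtype.2 (exists_ne a)
  obtain ⟨j, hj⟩ := exists_eq_ciSup_of_finite (f := fun i => (ϑ i : ℝ))
  refine ⟨j, hj.symm, fun i => ?_⟩
  have := le_ciSup (f := fun i => (ϑ i : ℝ)) (Set.finite_range _).bddAbove i
  rw [← hj] at this
  exact this

lemma iSup_mem [Nontrivial (Fin K)] (a : Fin K) (ϑ : {i : Fin K // i ≠ a} → F.Θ) :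
    (⨆ i, (ϑ i : ℝ)) ∈ F.Θ := by
  obtain ⟨j, hj, -⟩ := F.exists_eq_iSup a ϑ
  rw [hj]
  exact (ϑ j).2

lemma ofReal_le_gap_insertAt [Nontrivial (Fin K)] (a : Fin K) (x : F.Θ)
    (ϑ : {i : Fin K // i ≠ a} → F.Θ) :
    ENNReal.ofReal (F.mean ⟨_, F.iSup_mem a ϑ⟩ - F.mean x) ≤ F.gap a (insertAt a x ϑ) := by
  obtain ⟨j, hj, -⟩ := F.exists_eq_iSup a ϑ
  have h : (⟨_, F.iSup_mem a ϑ⟩ : F.Θ) = ϑ j := Subtype.ext hj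
  rw [h, gap, insertAt_self]
  refine ENNReal.ofReal_le_ofReal (sub_le_sub_right ?_ _)
  have := le_ciSup (f := fun i => F.mean (insertAt a x ϑ i)) (Set.finite_range _).bddAbove j
  simpa using this

lemma ofReal_le_lead_insertAt [Nontrivial (Fin K)] (a : Fin K) (x : F.Θ)
    (ϑ : {i : Fin K // i ≠ a} → F.Θ) :
    ENNReal.ofReal (F.mean x - F.mean ⟨_, F.iSup_mem a ϑ⟩) ≤ F.lead a (insertAt a x ϑ) := by
  have : Nonempty {i : Fin K // i ≠ a} := nonempty_subtype.2 (exists_ne a)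
  obtain ⟨j, hj, hle⟩ := F.exists_eq_iSup a ϑ
  have h : (⟨_, F.iSup_mem a ϑ⟩ : F.Θ) = ϑ j := Subtype.ext hj
  rw [h, lead, insertAt_self]
  refine ENNReal.ofReal_le_ofReal (sub_le_sub_left (ciSup_le fun i => ?_) _)
  simpa using F.strictMono_mean.monotone (hle i)

/-- The weighted cost, for one value of the other parameters, of the two errors on arm `a`. -/
lemma ofReal_le_gap_add_lead [Nontrivial (Fin K)] (𝒜 : Strategy K) (a : Fin K) (x x' : F.Θ)
    (ϑ : {i : Fin K // i ≠ a} → F.Θ) {T : ℕ} (hT : 0 < T) {D c ε v δ : ℝ}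
    (hε : 0 < ε) (hε1 : ε < 1) (hv : 0 < v) (hδ : 0 < δ)
    (h1 : (1 - ε) * v * δ ≤ F.mean ⟨_, F.iSup_mem a ϑ⟩ - F.mean x)
    (h2 : (1 - ε) * v * (ε * δ) ≤ F.mean x' - F.mean ⟨_, F.iSup_mem a ϑ⟩)
    (hD0 : 0 < D) (hD : F.kl x x' ≤ D) (hc : 0 ≤ c) (hcD : Real.exp c / T ≤ ε ^ 3 * D) :
    ENNReal.ofReal ((1 - ε) * v * δ / (D + c / T) * c) ≤
      F.gap a (insertAt a x ϑ) * F.expPulls 𝒜 T a (insertAt a x ϑ) +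
        ENNReal.ofReal (ε * ε) *
          (F.lead a (insertAt a x' ϑ) * F.expMisses 𝒜 T a (insertAt a x' ϑ)) := by
  have hT1 : (0 : ℝ) < T := by exact_mod_cast hT
  have h0 : 0 < (1 - ε) * v * δ := by have := sub_pos.2 hε1; positivity
  have hDc : 0 < D + c / T := by positivity
  -- Multiplying the information inequality by `w` turns the coefficient of the draws into the lower
  -- bound (1 - ε) v δ for the gap. By `hcD` the coefficient of the misses is then at most ε³ (1 -
  -- ε) v δ, that is ε² times the lower bound for the lead at t + ε δ.
  set w := (1 - ε) * v * δ / (D + c / T) with hw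
  have hw0 : 0 < w := by positivity
  have key := mul_le_mul_right (F.le_add_lintegral_pulls 𝒜 a x x' ϑ hT hD0.le hD hc)
    (ENNReal.ofReal w)
  rw [← ENNReal.ofReal_mul hw0.le, mul_add, ← mul_assoc, ← mul_assoc,
    ← ENNReal.ofReal_mul hw0.le, ← ENNReal.ofReal_mul hw0.le] at key
  refine key.trans ?_
  rw [add_comm]
  change ENNReal.ofReal _ * F.expPulls 𝒜 T a _ + ENNReal.ofReal _ * F.expMisses 𝒜 T a _ ≤ _
  have e1 : w * (D + c / T) ≤ F.mean ⟨_, F.iSup_mem a ϑ⟩ - F.mean x := by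
    rwa [hw, div_mul_cancel₀ _ hDc.ne']
  have e2 : w * (Real.exp c / T) ≤
      ε * ε * (F.mean x' - F.mean ⟨_, F.iSup_mem a ϑ⟩) := by
    calc w * (Real.exp c / T) ≤ w * (ε ^ 3 * D) := by gcongr
      _ ≤ w * (ε ^ 3 * (D + c / T)) := by
        have : 0 ≤ c / T := by positivity
        gcongr
        linarith
      _ = ε * ε * ((1 - ε) * v * (ε * δ)) := by
        rw [hw]; field_simp
      _ ≤ _ := by gcongr
  rw [← mul_assoc (ENNReal.ofReal (ε * ε))]
  refine add_le_add (mul_le_mul_left ?_ _) (mul_le_mul_left ?_ _)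
  · exact (ENNReal.ofReal_le_ofReal e1).trans (F.ofReal_le_gap_insertAt a x ϑ)
  · refine (ENNReal.ofReal_le_ofReal e2).trans ?_
    rw [ENNReal.ofReal_mul (by positivity)]
    exact mul_le_mul_right (F.ofReal_le_lead_insertAt a x' ϑ) _

end ExpFamily

/-! ### Translations of a density, substitution and limit of the weight -/

/-- Translations act continuously on L¹, and convergence in L¹ gives almost everywhere convergence
along a subsequence. -/
lemma exists_subseq_ae_tendsto_translate {g : ℝ → ℝ} (hg : Integrable g) {δ : ℕ → ℝ}
    (hδ : Tendsto δ atTop (𝓝 0)) :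
    ∃ φ : ℕ → ℕ, StrictMono φ ∧
      ∀ᵐ x : ℝ, Tendsto (fun n => g (δ (φ n) + x)) atTop (𝓝 (g x)) := by
  have hg1 : MemLp g 1 := memLp_one_iff_integrable.2 hg
  set G : Lp ℝ 1 (volume : Measure ℝ) := hg1.toLp g with hG
  have hG' : G =ᵐ[volume] g := hg1.coeFn_toLp
  have : Fact ((1 : ℝ≥0∞) ≠ ∞) := ⟨ENNReal.one_ne_top⟩
  have hlim : Tendsto (fun n => DomAddAct.mk (δ n) +ᵥ G) atTop (𝓝 G) := by
    have h1 : Continuous fun c : ℝᵈᵃᵃ => c +ᵥ G := continuous_id.vadd continuous_const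
    have h2 : Tendsto (fun n => DomAddAct.mk (δ n)) atTop (𝓝 (0 : ℝᵈᵃᵃ)) :=
      (DomAddAct.continuous_mk.tendsto 0).comp hδ
    have := (h1.tendsto 0).comp h2
    rwa [zero_vadd] at this
  obtain ⟨φ, hφ, hae⟩ := (tendstoInMeasure_of_tendsto_Lp hlim).exists_seq_tendsto_ae
  refine ⟨φ, hφ, ?_⟩
  have htr : ∀ n, ∀ᵐ x : ℝ, (DomAddAct.mk (δ n) +ᵥ G : Lp ℝ 1 (volume : Measure ℝ)) x =
      g (δ n + x) := by
    intro n
    have h1 := DomAddAct.vadd_Lp_ae_eq (DomAddAct.mk (δ n)) G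
    have h2 := (measurePreserving_add_left (volume : Measure ℝ) (δ n)).quasiMeasurePreserving.ae hG'
    filter_upwards [h1, h2] with x hx1 hx2
    rw [hx1]
    exact hx2
  filter_upwards [hae, hG', ae_all_iff.2 htr] with x h1 h2 h3
  rw [h2] at h1
  exact h1.congr fun n => h3 (φ n)

/-- Fatou's lemma with a weight that converges only in measure. -/
lemma lintegral_mul_le_liminf_translate {E : Type*} [MeasurableSpace E] {ρ : Measure E} {t : E → ℝ}
    (ht : Measurable t) (hac : ρ.map t ≪ volume) {g : ℝ → ℝ} (hg : Integrable g)
    (hgm : Measurable g) {δ δ' : ℕ → ℝ} (hδ : Tendsto δ atTop (𝓝 0)) (hδ' : Tendsto δ' atTop (𝓝 0))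
    {G : ℕ → E → ℝ≥0∞} (hG : ∀ n, Measurable (G n)) {W : ℝ≥0∞}
    (hW : ∀ e, W ≤ liminf (fun n => G n e) atTop) :
    (∫⁻ e, ENNReal.ofReal (g (t e)) ∂ρ) * W ≤
      liminf (fun n => ∫⁻ e, min (ENNReal.ofReal (g (δ n + t e)))
        (ENNReal.ofReal (g (δ' n + t e))) * G n e ∂ρ) atTop := by
  set I : ℕ → ℝ≥0∞ := fun n => ∫⁻ e, min (ENNReal.ofReal (g (δ n + t e)))
    (ENNReal.ofReal (g (δ' n + t e))) * G n e ∂ρ with hI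
  by_contra! hlt
  -- If the bound failed, some subsequence would stay below `y`; both translates converge almost
  -- everywhere along a further subsequence, where the usual Fatou lemma gives a contradiction.
  obtain ⟨y, hy1, hy2⟩ := exists_between hlt
  obtain ⟨φ, hφ, hφy⟩ := extraction_of_frequently_atTop
    (frequently_lt_of_liminf_lt (by isBoundedDefault) hy1)
  obtain ⟨φ₁, hφ₁, h1⟩ := exists_subseq_ae_tendsto_translate hg (hδ.comp hφ.tendsto_atTop)
  obtain ⟨φ₂, hφ₂, h2⟩ := exists_subseq_ae_tendsto_translate hg
    (hδ'.comp (hφ.comp hφ₁).tendsto_atTop)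
  set ψ : ℕ → ℕ := fun n => φ (φ₁ (φ₂ n)) with hψ
  have hψt : Tendsto ψ atTop atTop := (hφ.comp (hφ₁.comp hφ₂)).tendsto_atTop
  have hlim : ∀ᵐ x : ℝ, Tendsto (fun n => min (ENNReal.ofReal (g (δ (ψ n) + x)))
      (ENNReal.ofReal (g (δ' (ψ n) + x)))) atTop (𝓝 (ENNReal.ofReal (g x))) := by
    filter_upwards [h1, h2] with x hx1 hx2
    have hx1' := hx1.comp hφ₂.tendsto_atTop
    have := (ENNReal.tendsto_ofReal hx1').min (ENNReal.tendsto_ofReal hx2)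
    rwa [min_self] at this
  have hlim' := ae_of_ae_map ht.aemeasurable (hac.ae_le hlim)
  have hfatou : (∫⁻ e, ENNReal.ofReal (g (t e)) ∂ρ) * W ≤ liminf (fun n => I (ψ n)) atTop := by
    rw [← lintegral_mul_const _ (by fun_prop)]
    refine le_trans (lintegral_mono_ae ?_) (lintegral_liminf_le fun n => ?_)
    · filter_upwards [hlim'] with e he
      refine le_trans ?_ ENNReal.le_liminf_mul
      rw [he.liminf_eq]
      refine mul_le_mul_right ((hW e).trans ?_) _
      exact liminf_le_liminf_of_le hψt
    · have := hG (ψ n)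
      fun_prop
  have hle : liminf (fun n => I (ψ n)) atTop ≤ y :=
    liminf_le_of_frequently_le' (Frequently.of_forall fun n => (hφy _).le)
  exact absurd (hfatou.trans hle) (not_le.2 hy2)

/-- The substitution `x = t + s * exp (-u L)`. -/
lemma lintegral_exp_substitution_le {L : ℝ} (hL : 0 < L) (t : ℝ) {s : ℝ} (hs : s ≠ 0)
    {S : Set ℝ} (hS : ∀ u, t + s * Real.exp (-u * L) ∈ S) (f : ℝ → ℝ≥0∞) :
    ∫⁻ u in Set.Ioo (0 : ℝ) 2⁻¹,
        ENNReal.ofReal (|s| * (L * Real.exp (-u * L))) * f (t + s * Real.exp (-u * L)) ≤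
      ∫⁻ x in S, f x := by
  have hd : ∀ u ∈ Set.Ioo (0 : ℝ) 2⁻¹, HasDerivWithinAt (fun u => t + s * Real.exp (-u * L))
      (s * (Real.exp (-u * L) * (-1 * L))) (Set.Ioo (0 : ℝ) 2⁻¹) u := fun u _ =>
    (((((hasDerivAt_id u).neg.mul_const L).exp).const_mul s).const_add t).hasDerivWithinAt
  have hinj : Set.InjOn (fun u => t + s * Real.exp (-u * L)) (Set.Ioo (0 : ℝ) 2⁻¹) := by
    intro u _ v _ huv
    have h1 := Real.exp_injective (mul_left_cancel₀ hs (add_left_cancel huv))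
    have h2 := mul_right_cancel₀ hL.ne' h1
    linarith
  have h := lintegral_image_eq_lintegral_abs_deriv_mul measurableSet_Ioo hd hinj f
  have habs : ∀ u, |s * (Real.exp (-u * L) * (-1 * L))| = |s| * (L * Real.exp (-u * L)) := by
    intro u
    rw [abs_mul, abs_mul, abs_of_pos (Real.exp_pos _), neg_one_mul, abs_neg, abs_of_pos hL]
    ring
  simp only [habs] at h
  rw [← h]
  refine lintegral_mono_set ?_
  rintro _ ⟨u, _, rfl⟩
  exact hS u

/-- The limit of the normalized regret bound at the distance `T ^ (-u)`. -/
lemma tendsto_weight {A D₀ m r : ℝ} (hA : 0 < A) (hD : 0 < D₀) (hr : 0 < r) :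
    Tendsto (fun L : ℝ => m / (D₀ + Real.log (A * Real.exp (r * L)) / Real.exp (r * L)) *
      (Real.log (A * Real.exp (r * L)) / L)) atTop (𝓝 (m / D₀ * r)) := by
  have h0 : Tendsto (fun L : ℝ => r * L) atTop atTop := tendsto_id.const_mul_atTop hr
  have h1 : Tendsto (fun L : ℝ => Real.log (A * Real.exp (r * L)) / Real.exp (r * L)) atTop
      (𝓝 0) := by
    have e : ∀ L, Real.log (A * Real.exp (r * L)) / Real.exp (r * L) =
        Real.log A * (Real.exp (r * L))⁻¹ + (r * L) ^ 1 * Real.exp (-(r * L)) := fun L => by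
      rw [Real.log_mul hA.ne' (Real.exp_pos _).ne', Real.log_exp, Real.exp_neg]
      ring
    simp only [e]
    have a1 := (tendsto_inv_atTop_zero.comp (Real.tendsto_exp_atTop.comp h0)).const_mul
      (Real.log A)
    have a2 := (Real.tendsto_pow_mul_exp_neg_atTop_nhds_zero 1).comp h0
    simpa using a1.add a2
  have h2 : Tendsto (fun L : ℝ => Real.log (A * Real.exp (r * L)) / L) atTop (𝓝 r) := by
    have e : ∀ᶠ L : ℝ in atTop, Real.log A * L⁻¹ + r = Real.log (A * Real.exp (r * L)) / L := by
      filter_upwards [eventually_gt_atTop 0] with L hL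
      rw [Real.log_mul hA.ne' (Real.exp_pos _).ne', Real.log_exp]
      field_simp
    refine Tendsto.congr' e ?_
    simpa using (tendsto_inv_atTop_zero.const_mul (Real.log A)).add_const r
  have h3 := (tendsto_const_nhds (x := m)).div (h1.const_add D₀) (by simpa using hD.ne')
  simpa using h3.mul h2

/-! ### Integration over the prior -/

namespace ExpFamily

variable (F : ExpFamily) {K : ℕ}

open scoped Classical in
/-- A retraction of the real line onto the parameter set. -/
def proj (x : ℝ) : F.Θ :=
  ⟨if x ∈ F.Θ then x else F.nonempty_Θ.some, by
    split_ifs with h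
    exacts [h, F.nonempty_Θ.some_mem]⟩

lemma proj_of_mem {x : ℝ} (hx : x ∈ F.Θ) : F.proj x = ⟨x, hx⟩ := by simp [proj, hx]

@[simp] lemma proj_coe (θ : F.Θ) : F.proj θ = θ := F.proj_of_mem θ.2

lemma measurable_proj : Measurable F.proj :=
  (Measurable.ite F.isOpen_Θ.measurableSet measurable_id measurable_const).subtype_mk

/-- The part of the regret due to arm `a`, as a function of the parameters. -/
def loss (𝒜 : Strategy K) (T : ℕ) (a : Fin K) (p : ℝ × ({i : Fin K // i ≠ a} → F.Θ)) : ℝ≥0∞ :=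
  F.gap a (insertAt a (F.proj p.1) p.2) * F.expPulls 𝒜 T a (insertAt a (F.proj p.1) p.2)

/-- A lower bound on the regret when arm `a` is the best one, as a function of the parameters. -/
def leadLoss (𝒜 : Strategy K) (T : ℕ) (a : Fin K) (p : ℝ × ({i : Fin K // i ≠ a} → F.Θ)) :
    ℝ≥0∞ :=
  F.lead a (insertAt a (F.proj p.1) p.2) * F.expMisses 𝒜 T a (insertAt a (F.proj p.1) p.2)

lemma measurable_insertAt_proj (a : Fin K) :
    Measurable fun p : ℝ × ({i : Fin K // i ≠ a} → F.Θ) => insertAt a (F.proj p.1) p.2 :=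
  (measurable_insertAt a).comp ((F.measurable_proj.comp measurable_fst).prodMk measurable_snd)

@[fun_prop]
lemma measurable_loss (𝒜 : Strategy K) (T : ℕ) (a : Fin K) : Measurable (F.loss 𝒜 T a) :=
  ((F.measurable_gap a).mul (F.measurable_expPulls 𝒜 T a)).comp (F.measurable_insertAt_proj a)

@[fun_prop]
lemma measurable_leadLoss (𝒜 : Strategy K) (T : ℕ) (a : Fin K) : Measurable (F.leadLoss 𝒜 T a) :=
  ((F.measurable_lead a).mul (F.measurable_expMisses 𝒜 T a)).comp (F.measurable_insertAt_proj a)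

/-- The combined loss, over `log² T`, at distance `T ^ (-u)` below the best of the other arms and
at `ε` times this distance above it. -/
def pairLoss (𝒜 : ℕ → Strategy K) (a : Fin K) (ε : ℝ) (T : ℕ)
    (p : ℝ × ({i : Fin K // i ≠ a} → F.Θ)) : ℝ≥0∞ :=
  ENNReal.ofReal (Real.log T * Real.exp (-p.1 * Real.log T)) *
    (F.loss (𝒜 T) T a ((⨆ i, (p.2 i : ℝ)) + -1 * Real.exp (-p.1 * Real.log T), p.2) +
      ENNReal.ofReal (ε * ε) *
        F.leadLoss (𝒜 T) T a ((⨆ i, (p.2 i : ℝ)) + ε * Real.exp (-p.1 * Real.log T), p.2)) /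
    ENNReal.ofReal (Real.log T ^ 2)

lemma measurable_iSup_coe (a : Fin K) :
    Measurable fun ϑ : {i : Fin K // i ≠ a} → F.Θ => ⨆ i, (ϑ i : ℝ) :=
  Measurable.iSup fun i => measurable_subtype_coe.comp (measurable_pi_apply i)

lemma measurable_pairLoss (𝒜 : ℕ → Strategy K) (a : Fin K) (ε : ℝ) (T : ℕ) :
    Measurable (F.pairLoss 𝒜 a ε T) := by
  have h1 := (F.measurable_iSup_coe a).comp
    (measurable_snd : Measurable fun p : ℝ × ({i : Fin K // i ≠ a} → F.Θ) => p.2)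
  have h2 : ∀ s : ℝ, Measurable fun p : ℝ × ({i : Fin K // i ≠ a} → F.Θ) =>
      ((⨆ i, (p.2 i : ℝ)) + s * Real.exp (-p.1 * Real.log T), p.2) := fun s =>
    (h1.add (by fun_prop)).prodMk measurable_snd
  have h3 := (F.measurable_loss (𝒜 T) T a).comp (h2 (-1))
  have h4 := (F.measurable_leadLoss (𝒜 T) T a).comp (h2 ε)
  exact ((by fun_prop : Measurable fun p : ℝ × ({i : Fin K // i ≠ a} → F.Θ) =>
    ENNReal.ofReal (Real.log T * Real.exp (-p.1 * Real.log T))).mul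
      (h3.add (h4.const_mul _))).div_const _

lemma tendsto_log_natCast : Tendsto (fun T : ℕ => Real.log T) atTop atTop :=
  Real.tendsto_log_atTop.comp tendsto_natCast_atTop_atTop

lemma tendsto_exp_neg_mul_log {u : ℝ} (hu : 0 < u) :
    Tendsto (fun T : ℕ => Real.exp (-u * Real.log T)) atTop (𝓝 0) :=
  Real.tendsto_exp_atBot.comp (tendsto_log_natCast.const_mul_atTop_of_neg (neg_lt_zero.2 hu))

/-- The two-point bound is applied with δ = T^(-u) and D = D₀ δ², and c is chosen so that e^c / T =
ε³ D. Then c grows like (1 - 2u) log T, which is why u must stay below 1/2. -/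
lemma le_liminf_pairLoss [Nontrivial (Fin K)] (𝒜 : ℕ → Strategy K) (a : Fin K) {ε : ℝ}
    (hε : 0 < ε) (hε1 : ε < 1) {u : ℝ} (hu : u ∈ Set.Ioo (0 : ℝ) 2⁻¹)
    (ϑ : {i : Fin K // i ≠ a} → F.Θ) :
    ENNReal.ofReal (2 * (1 - ε) / (1 + ε) ^ 3 * (1 - 2 * u)) ≤
      liminf (fun T => F.pairLoss 𝒜 a ε T (u, ϑ)) atTop := by
  obtain ⟨hu0, hu1⟩ := hu
  have ht := F.iSup_mem a ϑ
  set t : ℝ := ⨆ i, (ϑ i : ℝ) with ht_def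
  obtain ⟨v, hv, hloc⟩ := F.eventually_local_bounds ht hε
  have hr : 0 < 1 - 2 * u := by linarith
  set r := 1 - 2 * u with hr_def
  set D₀ := (1 + ε) * v * (1 + ε) ^ 2 / 2 with hD₀
  have hD₀0 : 0 < D₀ := by positivity
  set A := ε ^ 3 * D₀ with hA
  have hA0 : 0 < A := by positivity
  set m := (1 - ε) * v with hm
  have hlim : Tendsto (fun T : ℕ => ENNReal.ofReal
      (m / (D₀ + Real.log (A * Real.exp (r * Real.log T)) / Real.exp (r * Real.log T)) *
        (Real.log (A * Real.exp (r * Real.log T)) / Real.log T))) atTop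
      (𝓝 (ENNReal.ofReal (2 * (1 - ε) / (1 + ε) ^ 3 * r))) := by
    have e : 2 * (1 - ε) / (1 + ε) ^ 3 * r = m / D₀ * r := by
      rw [hm, hD₀]; field_simp
    rw [e]
    exact ENNReal.tendsto_ofReal ((tendsto_weight hA0 hD₀0 hr).comp tendsto_log_natCast)
  rw [← hlim.liminf_eq]
  refine liminf_le_liminf ?_
  have hδ : Tendsto (fun T : ℕ => Real.exp (-u * Real.log T)) atTop (𝓝[>] 0) :=
    tendsto_nhdsWithin_iff.2 ⟨tendsto_exp_neg_mul_log hu0, Eventually.of_forall fun T =>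
      Real.exp_pos _⟩
  have hc : ∀ᶠ T : ℕ in atTop, 0 ≤ Real.log (A * Real.exp (r * Real.log T)) := by
    have h1 : Tendsto (fun T : ℕ => A * Real.exp (r * Real.log T)) atTop atTop :=
      (Real.tendsto_exp_atTop.comp (tendsto_log_natCast.const_mul_atTop hr)).const_mul_atTop hA0
    filter_upwards [h1.eventually_ge_atTop 1] with T hT using Real.log_nonneg hT
  filter_upwards [hδ.eventually hloc, hc, tendsto_log_natCast.eventually_gt_atTop 0,
    eventually_gt_atTop 0] with T ⟨hm', hp', h1, h2, hD⟩ hc hL hT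
  have hT1 : (0 : ℝ) < T := by exact_mod_cast hT
  set L := Real.log T with hL_def
  set δ := Real.exp (-u * L) with hδ_def
  have hδ0 : 0 < δ := Real.exp_pos _
  set c := Real.log (A * Real.exp (r * L)) with hc_def
  -- As r = 1 - 2u, this is T^(1 - 2u), the quantity inside the logarithm defining `c` up to the
  -- factor `A`.
  have hexp : Real.exp (r * L) = T * δ ^ 2 := by
    have : (T : ℝ) = Real.exp L := (Real.exp_log hT1).symm
    rw [this, hδ_def, ← Real.exp_nat_mul, ← Real.exp_add, hr_def]
    congr 1
    push_cast
    ring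
  have hpair := F.ofReal_le_gap_add_lead (𝒜 T) a ⟨t - δ, hm'⟩ ⟨t + ε * δ, hp'⟩ ϑ hT
    (D := D₀ * δ ^ 2) (c := c) hε hε1 hv hδ0 h1 h2 (by positivity)
    (hD.trans (le_of_eq (by rw [hD₀]; ring))) hc (by
      rw [hc_def, Real.exp_log (by positivity), hexp, hA]
      refine le_of_eq ?_
      field_simp)
  have hval : m / (D₀ + c / Real.exp (r * L)) * (c / L) =
      L * δ * ((1 - ε) * v * δ / (D₀ * δ ^ 2 + c / T) * c) / L ^ 2 := by
    have h3 : D₀ * δ ^ 2 + c / T = (D₀ + c / (T * δ ^ 2)) * δ ^ 2 := by field_simp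
    have h4 : 0 < D₀ + c / (T * δ ^ 2) := by positivity
    rw [hexp, h3, hm]
    field_simp
  have hw0 : 0 ≤ (1 - ε) * v * δ / (D₀ * δ ^ 2 + c / T) * c := by
    have := sub_pos.2 hε1
    positivity
  rw [hval, ENNReal.ofReal_div_of_pos (by positivity), ENNReal.ofReal_mul (by positivity)]
  unfold pairLoss loss leadLoss
  simp only
  rw [← hL_def, ← hδ_def, ← ht_def, show t + -1 * δ = t - δ by ring, F.proj_of_mem hm',
    F.proj_of_mem hp']
  gcongr

/-- Extending the density by zero allows translations and substitutions on the whole line, and makes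
the values of `proj` outside `Θ` irrelevant. -/
lemma lintegral_withDensity_lebesgue {h : ℝ → ℝ} (h_meas : Measurable h) {f : ℝ → ℝ≥0∞}
    (hf : Measurable f) :
    ∫⁻ θ, f θ ∂(F.lebesgue.withDensity fun θ => ENNReal.ofReal (h θ)) =
      ∫⁻ x, ENNReal.ofReal (F.Θ.indicator h x) * f x := by
  have h1 : Measurable fun θ : F.Θ => f θ := hf.comp measurable_subtype_coe
  have h2 : Measurable fun θ : F.Θ => ENNReal.ofReal (h θ) :=
    (h_meas.comp measurable_subtype_coe).ennreal_ofReal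
  rw [lintegral_withDensity_eq_lintegral_mul _ h2 h1, lebesgue]
  simp only [Pi.mul_apply]
  rw [lintegral_subtype_comap F.isOpen_Θ.measurableSet fun x => ENNReal.ofReal (h x) * f x,
    ← lintegral_indicator F.isOpen_Θ.measurableSet]
  refine lintegral_congr fun x => ?_
  by_cases hx : x ∈ F.Θ <;> simp [hx]

lemma integrable_indicator {h : ℝ → ℝ} (h_meas : Measurable h) (h_pos : ∀ θ ∈ F.Θ, 0 < h θ)
    [IsProbabilityMeasure (F.lebesgue.withDensity fun θ => ENNReal.ofReal (h θ))] :
    Integrable (F.Θ.indicator h) := by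
  refine ⟨(h_meas.indicator F.isOpen_Θ.measurableSet).aestronglyMeasurable, ?_⟩
  rw [hasFiniteIntegral_iff_ofReal (ae_of_all _ fun x => Set.indicator_nonneg
    (fun θ hθ => (h_pos θ hθ).le) x)]
  have := F.lintegral_withDensity_lebesgue h_meas (f := fun _ => 1) measurable_const
  simp only [lintegral_one, measure_univ, mul_one] at this
  rw [← this]
  exact ENNReal.one_lt_top

/-- The maximum equals one of finitely many coordinates, each with a density. Almost everywhere
convergence of the translates on the line thus holds at the maximum for almost all ϑ. -/
lemma absolutelyContinuous_map_iSup [Nontrivial (Fin K)] (π : Fin K → Measure F.Θ)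
    [∀ a, IsProbabilityMeasure (π a)] {h : Fin K → ℝ → ℝ}
    (h_dens : ∀ a, π a = F.lebesgue.withDensity fun θ => ENNReal.ofReal (h a θ)) (a : Fin K) :
    (Measure.pi fun i : {i : Fin K // i ≠ a} => π i).map (fun ϑ => ⨆ i, (ϑ i : ℝ)) ≪ volume := by
  refine Measure.AbsolutelyContinuous.mk fun s hs hs0 => ?_
  rw [Measure.map_apply (F.measurable_iSup_coe a) hs]
  have hsub : (fun ϑ : {i : Fin K // i ≠ a} → F.Θ => ⨆ i, (ϑ i : ℝ)) ⁻¹' s ⊆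
      ⋃ i, Function.eval i ⁻¹' (Subtype.val ⁻¹' s : Set F.Θ) := by
    intro ϑ hϑ
    obtain ⟨j, hj, -⟩ := F.exists_eq_iSup a ϑ
    rw [Set.mem_preimage, hj] at hϑ
    exact Set.mem_iUnion.2 ⟨j, hϑ⟩
  refine measure_mono_null hsub (measure_iUnion_null fun i => ?_)
  have hm : MeasurableSet (Subtype.val ⁻¹' s : Set F.Θ) := measurable_subtype_coe hs
  rw [(measurePreserving_eval (fun i : {i : Fin K // i ≠ a} => π i) i).measure_preimage
    hm.nullMeasurableSet, h_dens]
  refine withDensity_absolutelyContinuous _ _ ?_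
  rw [lebesgue, (MeasurableEmbedding.subtype_coe F.isOpen_Θ.measurableSet).comap_apply]
  exact measure_mono_null (Set.image_preimage_subset _ _) hs0

/-- The substitutions `x = t - T ^ (-u)` and `x = t + ε T ^ (-u)`, for fixed values of the other
parameters. -/
lemma lintegral_mul_pairLoss_le (𝒜 : ℕ → Strategy K) (a : Fin K) {ε : ℝ} (hε : 0 < ε) {T : ℕ}
    (hT : 0 < Real.log T) {k : ℝ → ℝ≥0∞} (hk : Measurable k)
    (ϑ : {i : Fin K // i ≠ a} → F.Θ) :
    ∫⁻ u in Set.Ioo (0 : ℝ) 2⁻¹,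
        min (k ((⨆ i, (ϑ i : ℝ)) + -1 * Real.exp (-u * Real.log T)))
          (k ((⨆ i, (ϑ i : ℝ)) + ε * Real.exp (-u * Real.log T))) * F.pairLoss 𝒜 a ε T (u, ϑ) ≤
      (∫⁻ x, k x * (F.loss (𝒜 T) T a (x, ϑ) + ENNReal.ofReal ε * F.leadLoss (𝒜 T) T a (x, ϑ))) /
        ENNReal.ofReal (Real.log T ^ 2) := by
  set t : ℝ := ⨆ i, (ϑ i : ℝ) with ht
  set L := Real.log T with hL
  have hl : Measurable fun x => F.loss (𝒜 T) T a (x, ϑ) :=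
    (F.measurable_loss (𝒜 T) T a).comp measurable_prodMk_right
  have hm : Measurable fun x => F.leadLoss (𝒜 T) T a (x, ϑ) :=
    (F.measurable_leadLoss (𝒜 T) T a).comp measurable_prodMk_right
  set f₁ : ℝ → ℝ≥0∞ := fun x => k x * F.loss (𝒜 T) T a (x, ϑ) with hf₁
  set f₂ : ℝ → ℝ≥0∞ := fun x => k x * (ENNReal.ofReal ε * F.leadLoss (𝒜 T) T a (x, ϑ)) with hf₂
  have hs₁ := lintegral_exp_substitution_le hT t (s := -1) (by norm_num) (S := Set.Iio t)
    (fun u => by have := Real.exp_pos (-u * L); simp only [Set.mem_Iio]; linarith) f₁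
  have hs₂ := lintegral_exp_substitution_le hT t (s := ε) hε.ne' (S := Set.Ici t)
    (fun u => by have := mul_pos hε (Real.exp_pos (-u * L)); simp only [Set.mem_Ici]; linarith) f₂
  -- The two substitutions land on complementary half-lines, so no parameter value is charged twice.
  have hsplit : (∫⁻ x in Set.Iio t, f₁ x) + ∫⁻ x in Set.Ici t, f₂ x ≤
      ∫⁻ x, k x * (F.loss (𝒜 T) T a (x, ϑ) + ENNReal.ofReal ε * F.leadLoss (𝒜 T) T a (x, ϑ)) := by
    rw [← lintegral_add_compl (fun x => k x * (F.loss (𝒜 T) T a (x, ϑ) +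
      ENNReal.ofReal ε * F.leadLoss (𝒜 T) T a (x, ϑ))) (measurableSet_Iio (a := t)), Set.compl_Iio]
    refine add_le_add (lintegral_mono fun x => ?_) (lintegral_mono fun x => ?_)
    · exact mul_le_mul_right le_self_add _
    · exact mul_le_mul_right le_add_self _
  have hmeas : Measurable fun u : ℝ => ENNReal.ofReal (|(-1 : ℝ)| * (L * Real.exp (-u * L))) *
      f₁ (t + -1 * Real.exp (-u * L)) := by
    have : Measurable f₁ := hk.mul hl
    fun_prop
  have hsum := add_le_add hs₁ hs₂
  rw [← lintegral_add_left hmeas] at hsum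
  have hL2 : ENNReal.ofReal (L ^ 2) ≠ 0 := (ENNReal.ofReal_pos.2 (pow_pos hT 2)).ne'
  have hL2inv : (ENNReal.ofReal (L ^ 2))⁻¹ ≠ ∞ := ENNReal.inv_ne_top.2 hL2
  rw [ENNReal.div_eq_inv_mul]
  refine le_trans ?_ (mul_le_mul_right (hsum.trans hsplit) _)
  rw [← lintegral_const_mul' _ _ hL2inv]
  refine lintegral_mono fun u => ?_
  simp only [pairLoss, ← ht, ← hL, hf₁, hf₂, ENNReal.div_eq_inv_mul]
  set δ := Real.exp (-u * L) with hδ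
  set m := min (k (t + -1 * δ)) (k (t + ε * δ)) with hm_def
  have hδ0 : 0 < δ := Real.exp_pos _
  rw [mul_left_comm m]
  refine mul_le_mul_right ?_ _
  rw [abs_neg, abs_one, one_mul, abs_of_pos hε, ENNReal.ofReal_mul hε.le (q := L * δ),
    ENNReal.ofReal_mul hε.le (q := ε)]
  set x := ENNReal.ofReal (L * δ)
  set e := ENNReal.ofReal ε
  set p := F.loss (𝒜 T) T a (t + -1 * δ, ϑ)
  set q := F.leadLoss (𝒜 T) T a (t + ε * δ, ϑ)
  -- One factor ε of the weight ε² is the Jacobian of the substitution above t; the other remains as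
  -- the weight of the lead loss. The minimum of the two densities serves both terms.
  calc m * (x * (p + e * e * q)) = x * (m * p) + e * x * (m * (e * q)) := by ring
    _ ≤ _ := by
      gcongr
      · exact min_le_left _ _
      · exact min_le_right _ _

lemma lintegral_pairLoss_le (π : Fin K → Measure F.Θ) [∀ a, IsProbabilityMeasure (π a)]
    {h : Fin K → ℝ → ℝ} (h_meas : ∀ a, Measurable (h a))
    (h_dens : ∀ a, π a = F.lebesgue.withDensity fun θ => ENNReal.ofReal (h a θ))
    (𝒜 : ℕ → Strategy K) (a : Fin K) {ε : ℝ} (hε : 0 < ε) {T : ℕ} (hT : 0 < Real.log T) :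
    ∫⁻ u in Set.Ioo (0 : ℝ) 2⁻¹, ∫⁻ ϑ,
        min (ENNReal.ofReal (F.Θ.indicator (h a)
            (-1 * Real.exp (-u * Real.log T) + ⨆ i, (ϑ i : ℝ))))
          (ENNReal.ofReal (F.Θ.indicator (h a)
            (ε * Real.exp (-u * Real.log T) + ⨆ i, (ϑ i : ℝ)))) *
          F.pairLoss 𝒜 a ε T (u, ϑ) ∂(Measure.pi fun i : {i : Fin K // i ≠ a} => π i) ≤
      (∫⁻ θ, (F.gap a θ * F.expPulls (𝒜 T) T a θ +
          ENNReal.ofReal ε * (F.lead a θ * F.expMisses (𝒜 T) T a θ)) ∂Measure.pi π) /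
        ENNReal.ofReal (Real.log T ^ 2) := by
  have hk : Measurable fun x => ENNReal.ofReal (F.Θ.indicator (h a) x) :=
    ((h_meas a).indicator F.isOpen_Θ.measurableSet).ennreal_ofReal
  have hS : Measurable fun θ : Fin K → F.Θ => F.gap a θ * F.expPulls (𝒜 T) T a θ +
      ENNReal.ofReal ε * (F.lead a θ * F.expMisses (𝒜 T) T a θ) :=
    ((F.measurable_gap a).mul (F.measurable_expPulls (𝒜 T) T a)).add
      (((F.measurable_lead a).mul (F.measurable_expMisses (𝒜 T) T a)).const_mul _)
  have hL2 : ENNReal.ofReal (Real.log T ^ 2) ≠ 0 := (ENNReal.ofReal_pos.2 (pow_pos hT 2)).ne'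
  rw [lintegral_pi_insertAt π a hS, ENNReal.div_eq_inv_mul,
    ← lintegral_const_mul' _ _ (ENNReal.inv_ne_top.2 hL2), lintegral_lintegral_swap]
  · refine lintegral_mono fun ϑ => ?_
    have hpt := F.lintegral_mul_pairLoss_le 𝒜 a hε hT hk ϑ
    have hmx : Measurable fun x => F.loss (𝒜 T) T a (x, ϑ) +
        ENNReal.ofReal ε * F.leadLoss (𝒜 T) T a (x, ϑ) := by
      have hl : Measurable fun x => F.loss (𝒜 T) T a (x, ϑ) :=
        (F.measurable_loss (𝒜 T) T a).comp measurable_prodMk_right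
      have hm : Measurable fun x => F.leadLoss (𝒜 T) T a (x, ϑ) :=
        (F.measurable_leadLoss (𝒜 T) T a).comp measurable_prodMk_right
      fun_prop
    rw [← F.lintegral_withDensity_lebesgue (h_meas a) hmx, ← h_dens,
      ENNReal.div_eq_inv_mul] at hpt
    simpa only [loss, leadLoss, proj_coe, add_comm (⨆ i, (ϑ i : ℝ))] using hpt
  · have h1 := (F.measurable_iSup_coe a).comp
      (measurable_snd : Measurable fun p : ℝ × ({i : Fin K // i ≠ a} → F.Θ) => p.2)
    have h2 : ∀ s : ℝ, Measurable fun p : ℝ × ({i : Fin K // i ≠ a} → F.Θ) =>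
        ENNReal.ofReal (F.Θ.indicator (h a)
          (s * Real.exp (-p.1 * Real.log T) + ⨆ i, (p.2 i : ℝ))) := fun s =>
      hk.comp ((by fun_prop : Measurable fun p : ℝ × ({i : Fin K // i ≠ a} → F.Θ) =>
        s * Real.exp (-p.1 * Real.log T)).add h1)
    exact (((h2 (-1)).min (h2 ε)).mul (F.measurable_pairLoss 𝒜 a ε T)).aemeasurable

lemma lintegral_one_sub_two_mul {C : ℝ} (hC : 0 ≤ C) :
    ∫⁻ u in Set.Ioo (0 : ℝ) 2⁻¹, ENNReal.ofReal (C * (1 - 2 * u)) = ENNReal.ofReal (C / 4) := by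
  have hi : ∫ u in (0 : ℝ)..2⁻¹, C * (1 - 2 * u) = C / 4 := by
    rw [intervalIntegral.integral_const_mul, intervalIntegral.integral_sub (by simp)
      (by apply Continuous.intervalIntegrable; fun_prop), intervalIntegral.integral_const_mul]
    simp
    ring
  rw [← hi, intervalIntegral.integral_of_le (by norm_num), integral_Ioc_eq_integral_Ioo,
    ofReal_integral_eq_lintegral_ofReal]
  · refine Integrable.mono_measure (?_ : IntegrableOn _ (Set.Icc (0 : ℝ) 2⁻¹) _)
      (Measure.restrict_mono Set.Ioo_subset_Icc_self le_rfl)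
    exact ContinuousOn.integrableOn_Icc (by fun_prop)
  · filter_upwards [ae_restrict_mem measurableSet_Ioo] with u hu
    have := hu.2
    exact mul_nonneg hC (by linarith)

/-- The asymptotic lower bound on the losses due to one arm. -/
lemma mul_crossIntegral_le_liminf [Nontrivial (Fin K)] (π : Fin K → Measure F.Θ)
    [hπ : ∀ a, IsProbabilityMeasure (π a)] {h : Fin K → ℝ → ℝ} (h_meas : ∀ a, Measurable (h a))
    (h_pos : ∀ a, ∀ θ ∈ F.Θ, 0 < h a θ)
    (h_dens : ∀ a, π a = F.lebesgue.withDensity fun θ => ENNReal.ofReal (h a θ))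
    (𝒜 : ℕ → Strategy K) (a : Fin K) {ε : ℝ} (hε : 0 < ε) (hε1 : ε < 1) :
    ENNReal.ofReal (2⁻¹ * (1 - ε) / (1 + ε) ^ 3) * F.crossIntegral π (h a) a ≤
      liminf (fun T : ℕ => (∫⁻ θ, (F.gap a θ * F.expPulls (𝒜 T) T a θ +
          ENNReal.ofReal ε * (F.lead a θ * F.expMisses (𝒜 T) T a θ)) ∂Measure.pi π) /
        ENNReal.ofReal (Real.log T ^ 2)) atTop := by
  set ρ := Measure.pi fun i : {i : Fin K // i ≠ a} => π i with hρ
  set g := F.Θ.indicator (h a) with hg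
  have hgm : Measurable g := (h_meas a).indicator F.isOpen_Θ.measurableSet
  have hgi : Integrable g := by
    have := hπ a
    rw [h_dens] at this
    exact F.integrable_indicator (h_meas a) (h_pos a)
  have hcross : F.crossIntegral π (h a) a = ∫⁻ ϑ, ENNReal.ofReal (g (⨆ i, (ϑ i : ℝ))) ∂ρ :=
    lintegral_congr fun ϑ => by rw [hg, Set.indicator_of_mem (F.iSup_mem a ϑ)]
  set I : ℕ → ℝ → ℝ≥0∞ := fun T u => ∫⁻ ϑ,
    min (ENNReal.ofReal (g (-1 * Real.exp (-u * Real.log T) + ⨆ i, (ϑ i : ℝ))))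
      (ENNReal.ofReal (g (ε * Real.exp (-u * Real.log T) + ⨆ i, (ϑ i : ℝ)))) *
      F.pairLoss 𝒜 a ε T (u, ϑ) ∂ρ with hI
  have hIm : ∀ T, Measurable (I T) := by
    intro T
    have h1 := (F.measurable_iSup_coe a).comp
      (measurable_snd : Measurable fun p : ℝ × ({i : Fin K // i ≠ a} → F.Θ) => p.2)
    have h2 : ∀ s : ℝ, Measurable fun p : ℝ × ({i : Fin K // i ≠ a} → F.Θ) =>
        ENNReal.ofReal (g (s * Real.exp (-p.1 * Real.log T) + ⨆ i, (p.2 i : ℝ))) := fun s =>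
      hgm.ennreal_ofReal.comp ((by fun_prop : Measurable fun p : ℝ × ({i : Fin K // i ≠ a} → F.Θ) =>
        s * Real.exp (-p.1 * Real.log T)).add h1)
    exact Measurable.lintegral_prod_right'
      (((h2 (-1)).min (h2 ε)).mul (F.measurable_pairLoss 𝒜 a ε T))
  have hinner : ∀ u ∈ Set.Ioo (0 : ℝ) 2⁻¹, F.crossIntegral π (h a) a *
      ENNReal.ofReal (2 * (1 - ε) / (1 + ε) ^ 3 * (1 - 2 * u)) ≤
      liminf (fun T => I T u) atTop := by
    intro u hu
    have h0 := tendsto_exp_neg_mul_log hu.1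
    rw [hcross]
    exact lintegral_mul_le_liminf_translate (F.measurable_iSup_coe a)
      (F.absolutelyContinuous_map_iSup π h_dens a) hgi hgm (by simpa using h0.const_mul (-1))
      (by simpa using h0.const_mul ε)
      (G := fun T ϑ => F.pairLoss 𝒜 a ε T (u, ϑ))
      (fun T => (F.measurable_pairLoss 𝒜 a ε T).comp measurable_prodMk_left)
      (fun ϑ => F.le_liminf_pairLoss 𝒜 a hε hε1 hu ϑ)
  calc ENNReal.ofReal (2⁻¹ * (1 - ε) / (1 + ε) ^ 3) * F.crossIntegral π (h a) a
      = ∫⁻ u in Set.Ioo (0 : ℝ) 2⁻¹, F.crossIntegral π (h a) a *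
          ENNReal.ofReal (2 * (1 - ε) / (1 + ε) ^ 3 * (1 - 2 * u)) := by
        have := sub_pos.2 hε1
        -- The integral of 1 - 2u over (0, 1/2) is 1/4, which turns the constant 2 into 1/2.
        rw [lintegral_const_mul _ (by fun_prop), lintegral_one_sub_two_mul (by positivity),
          mul_comm]
        congr 2
        ring
    _ ≤ ∫⁻ u in Set.Ioo (0 : ℝ) 2⁻¹, liminf (fun T => I T u) atTop :=
        setLIntegral_mono' measurableSet_Ioo hinner
    _ ≤ liminf (fun T => ∫⁻ u in Set.Ioo (0 : ℝ) 2⁻¹, I T u) atTop := lintegral_liminf_le hIm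
    _ ≤ _ := by
        refine liminf_le_liminf ?_
        filter_upwards [tendsto_log_natCast.eventually_gt_atTop 0] with T hT
        exact F.lintegral_pairLoss_le π h_meas h_dens 𝒜 a hε hT

end ExpFamily

/-! ### Summation over the arms and the limit ε → 0 -/

/-- This is Fatou's lemma for the counting measure. -/
lemma sum_liminf_le_liminf_sum {K : ℕ} (f : Fin K → ℕ → ℝ≥0∞) :
    ∑ a, liminf (f a) atTop ≤ liminf (fun n => ∑ a, f a n) atTop := by
  simpa [lintegral_count] using lintegral_liminf_le (μ := (Measure.count : Measure (Fin K)))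
    (f := fun n a => f a n) (u := atTop) fun n => measurable_of_finite _

end Bandit

end

theorem theorem3 (F : Bandit.ExpFamily) (K : ℕ) (hK : 2 ≤ K)
    (π : Fin K → Measure F.Θ) (hπ : ∀ a, IsProbabilityMeasure (π a))
    (h : Fin K → ℝ → ℝ) (h_meas : ∀ a, Measurable (h a))
    (h_pos : ∀ a, ∀ θ ∈ F.Θ, 0 < h a θ)
    (h_dens : ∀ a, π a = F.lebesgue.withDensity fun θ => ENNReal.ofReal (h a θ))
    (h_fin : ∀ a, F.crossIntegral π (h a) a < ∞)
    (𝒜 : ℕ → Bandit.Strategy K) :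
    2⁻¹ * ∑ a, F.crossIntegral π (h a) a ≤
      liminf (fun T : ℕ => F.bayesRisk (Measure.pi π) (𝒜 T) T / ENNReal.ofReal (Real.log T ^ 2))
        atTop := by
  have : Nontrivial (Fin K) := Fin.nontrivial_iff_two_le.2 hK
  set R := liminf (fun T : ℕ => F.bayesRisk (Measure.pi π) (𝒜 T) T /
    ENNReal.ofReal (Real.log T ^ 2)) atTop with hR
  -- The factor 1 + ε pays for using the Bayes risk twice: once for the draws of inferior arms and,
  -- with weight ε, for the misses of the best arm.
  have hbound : ∀ ε : ℝ, 0 < ε → ε < 1 →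
      ENNReal.ofReal (2⁻¹ * (1 - ε) / (1 + ε) ^ 3) * ∑ a, F.crossIntegral π (h a) a ≤
        ENNReal.ofReal (1 + ε) * R := by
    intro ε hε hε1
    rw [Finset.mul_sum, hR, ← ENNReal.liminf_const_mul_of_ne_top ENNReal.ofReal_ne_top]
    refine (Finset.sum_le_sum fun a _ =>
      F.mul_crossIntegral_le_liminf π h_meas h_pos h_dens 𝒜 a hε hε1).trans
      ((Bandit.sum_liminf_le_liminf_sum _).trans (liminf_le_liminf (Eventually.of_forall
        fun T => ?_)))
    simp only [div_eq_mul_inv]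
    rw [← Finset.sum_mul, ← mul_assoc, ENNReal.ofReal_add zero_le_one hε.le, ENNReal.ofReal_one]
    exact mul_le_mul_left (F.sum_lintegral_le_bayesRisk (𝒜 T) T _ _) _
  have hl : Tendsto (fun ε : ℝ => ENNReal.ofReal (2⁻¹ * (1 - ε) / (1 + ε) ^ 3) *
      ∑ a, F.crossIntegral π (h a) a) (nhdsWithin 0 (Set.Ioi 0))
      (nhds (2⁻¹ * ∑ a, F.crossIntegral π (h a) a)) := by
    have h1 : ContinuousAt (fun ε : ℝ => 2⁻¹ * (1 - ε) / (1 + ε) ^ 3) 0 := by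
      refine ContinuousAt.div (by fun_prop) (by fun_prop) (by norm_num)
    have h2 := ENNReal.tendsto_ofReal (h1.tendsto.mono_left
      (nhdsWithin_le_nhds (s := Set.Ioi 0)))
    have h3 : ENNReal.ofReal (2⁻¹ * (1 - 0) / (1 + 0) ^ 3) = 2⁻¹ := by
      rw [show (2⁻¹ * (1 - 0) / (1 + 0) ^ 3 : ℝ) = 2⁻¹ by norm_num,
        ENNReal.ofReal_inv_of_pos two_pos, ENNReal.ofReal_ofNat]
    rw [h3] at h2
    exact ENNReal.Tendsto.mul_const h2 (Or.inl (by simp))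
  have hr : Tendsto (fun ε : ℝ => ENNReal.ofReal (1 + ε) * R) (nhdsWithin 0 (Set.Ioi 0))
      (nhds R) := by
    have h1 : ContinuousAt (fun ε : ℝ => 1 + ε) 0 := by fun_prop
    have h2 := ENNReal.tendsto_ofReal (h1.tendsto.mono_left
      (nhdsWithin_le_nhds (s := Set.Ioi 0)))
    rw [add_zero, ENNReal.ofReal_one] at h2
    simpa using ENNReal.Tendsto.mul_const h2 (Or.inl one_ne_zero) (b := R)
  refine le_of_tendsto_of_tendsto hl hr ?_
  filter_upwards [Ioo_mem_nhdsGT (zero_lt_one' ℝ)] with ε hε using hbound ε hε.1 hε.2
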